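/- Let $F$ be a field; if $\operatorname{char} F\neq 2$, assume that $-1$ is a square in $F$. Let $I_q^1F$ be the Witt group of even-dimensional nonsingular quadratic forms over $F$. A quadratic $n$-fold Pfister form ($n\ge 1$) is a form isometric to $\langle\langle\beta_1,\dots,\beta_{n-1}\rangle\rangle\otimes[1,\alpha]$, where $\beta_i\in F^\times$, $\alpha\in F$ with $4\alpha\neq 1$, $[1,\alpha]$ is the form $u_1^2+u_1u_2+\alpha u_2^2$, and $\langle\langle\beta_1,\dots,\beta_m\rangle\rangle\otimes\varphi$ is defined by iterating $\langle\langle\beta\rangle\rangle\otimes\varphi=\varphi\perp\beta\varphi$. Let $I_q^nF\subseteq I_q^1F$ be the subgroup generated by the classes of scalar multiples of quadratic $n$-fold Pfister forms. Let $n\ge 2$ and let $S$ be a right-linked set of quadratic $n$-fold Pfister forms over $F$, that is, there is a quadratic $(n-1)$-fold Pfister form $\varphi$ such that every element of $S$ is isometric to $\langle\langle\beta\rangle\rangle\otimes\varphi$ for some $\beta\in F^\times$. Let $G$ be the subgroup of $I_q^nF/I_q^{n+1}F$ generated by the image of $S$, and suppose that $G$ has order $2^s$. Then every element of $G$ is represented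 by exactly one Witt class of quadratic $n$-fold Pfister forms, and the sum $\Sigma_S\in I_q^nF$ of these representatives, taken over all elements of $G$, is the Witt class of a quadratic $(n+s-1)$-fold Pfister form. More precisely, if $s\ge 1$ (which holds as soon as $S$ contains two non-isometric forms), then for every quadratic $(n-1)$-fold Pfister form $\varphi$ as above there are $\beta_1,\dots,\beta_s\in F^\times$ such that the elements of $G$ are exactly the classes of the forms $\langle\langle\prod_{i\in T}\beta_i\rangle\rangle\otimes\varphi$ for the subsets $T\subseteq\{1,\dots,s\}$, and $$\Sigma_S=\langle\langle\beta_1,\dots,\beta_s\rangle\rangle\otimes\varphi\quad\text{in } I_q^1F .$$ -/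

import Mathlib

universe u

noncomputable section

/-- A nonsingular quadratic form of even dimension over `F`. "Nonsingular" means that the polar
form `b(x, y) = q(x + y) - q(x) - q(y)` is nondegenerate; in characteristic two such a form is an
orthogonal sum of binary forms `[β, γ]`. -/
structure EvenForm (F : Type u) [Field F] : Type (u + 1) where
  carrier : Type u
  [addCommGroup : AddCommGroup carrier]
  [module : Module F carrier]
  [finite : FiniteDimensional F carrier]
  form : QuadraticForm F carrier
  nonsingular : ∀ x, (∀ y, QuadraticMap.polar form x y = 0) → x = 0
  even_dim : Even (Module.finrank F carrier)

namespace EvenForm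

variable {F : Type u} [Field F]

attribute [instance] EvenForm.addCommGroup EvenForm.module EvenForm.finite

/-- Isometry of quadratic forms. -/
def Isometric (φ ψ : EvenForm F) : Prop := φ.form.Equivalent ψ.form

theorem Isometric.refl (φ : EvenForm F) : Isometric φ φ := QuadraticMap.Equivalent.refl _

theorem Isometric.symm {φ ψ : EvenForm F} (h : Isometric φ ψ) : Isometric ψ φ :=
  QuadraticMap.Equivalent.symm h

theorem Isometric.trans {φ ψ χ : EvenForm F} (h : Isometric φ ψ) (h' : Isometric ψ χ) :
    Isometric φ χ :=
  QuadraticMap.Equivalent.trans h h'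

/-- The orthogonal sum `φ ⊥ ψ`. -/
def orthSum (φ ψ : EvenForm F) : EvenForm F where
  carrier := φ.carrier × ψ.carrier
  form := φ.form.prod ψ.form
  nonsingular := by
    rintro ⟨x, y⟩ h
    have h1 : x = 0 := φ.nonsingular x fun z => by simpa using h (z, 0)
    have h2 : y = 0 := ψ.nonsingular y fun z => by simpa using h (0, z)
    rw [h1, h2]; rfl
  even_dim := by
    rw [Module.finrank_prod]
    exact φ.even_dim.add ψ.even_dim

/-- The scalar multiple `a φ` of a form by a nonzero scalar `a`. -/
def scale (a : Fˣ) (φ : EvenForm F) : EvenForm F where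
  carrier := φ.carrier
  form := (a : F) • φ.form
  nonsingular := fun x h => φ.nonsingular x fun y => by
    have := h y
    rw [FunLike.coe_smul, QuadraticMap.polar_smul, smul_eq_mul] at this
    exact (mul_eq_zero.mp this).resolve_left a.ne_zero
  even_dim := φ.even_dim

/-- The hyperbolic form `(f, v) ↦ f v` on `V* × V`, an orthogonal sum of `dim V` hyperbolic planes
`(u₁, u₂) ↦ u₁ u₂`. -/
def hyperbolic (V : Type u) [AddCommGroup V] [Module F V] [FiniteDimensional F V] :
    EvenForm F where
  carrier := Module.Dual F V × V
  form := QuadraticForm.dualProd F V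
  nonsingular := by
    rintro ⟨f, v⟩ h
    have h1 : f = 0 := by
      ext w
      simpa [QuadraticMap.polar] using h (0, w)
    have h2 : v = 0 := by
      refine (Module.forall_dual_apply_eq_zero_iff F v).mp fun g => ?_
      simpa [QuadraticMap.polar] using h (g, 0)
    rw [h1, h2]; rfl
  even_dim := by
    rw [Module.finrank_prod, Subspace.dual_finrank_eq]
    exact ⟨_, rfl⟩

/-- Witt equivalence: the two forms become isometric after adding suitable numbers of hyperbolic
planes, `φ ⊥ iℍ ≅ ψ ⊥ jℍ`. By Witt decomposition and cancellation this says that the anisotropic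
parts of `φ` and `ψ` are isometric. -/
def WittEquiv (φ ψ : EvenForm F) : Prop :=
  ∃ i j : ℕ, Isometric (orthSum φ (hyperbolic (Fin i → F))) (orthSum ψ (hyperbolic (Fin j → F)))

theorem orthSum_congr {φ φ' ψ ψ' : EvenForm F} (h : Isometric φ φ') (h' : Isometric ψ ψ') :
    Isometric (orthSum φ ψ) (orthSum φ' ψ') :=
  QuadraticMap.Equivalent.prod h h'

theorem orthSum_comm (φ ψ : EvenForm F) : Isometric (orthSum φ ψ) (orthSum ψ φ) :=
  ⟨QuadraticMap.IsometryEquiv.prodComm _ _⟩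

theorem orthSum_assoc (φ ψ χ : EvenForm F) :
    Isometric (orthSum (orthSum φ ψ) χ) (orthSum φ (orthSum ψ χ)) :=
  ⟨{ toLinearEquiv := LinearEquiv.prodAssoc F _ _ _
     map_app' := fun _ => (add_assoc _ _ _).symm }⟩

theorem orthSum_orthSum_comm (φ ψ φ' ψ' : EvenForm F) :
    Isometric (orthSum (orthSum φ ψ) (orthSum φ' ψ'))
      (orthSum (orthSum φ φ') (orthSum ψ ψ')) :=
  ⟨QuadraticMap.IsometryEquiv.prodProdProdComm _ _ _ _⟩

theorem hyperbolic_prod (V W : Type u) [AddCommGroup V] [Module F V] [FiniteDimensional F V]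
    [AddCommGroup W] [Module F W] [FiniteDimensional F W] :
    Isometric (orthSum (hyperbolic (F := F) V) (hyperbolic W)) (hyperbolic (V × W)) :=
  QuadraticMap.Equivalent.symm ⟨QuadraticForm.dualProdProdIsometry⟩

theorem hyperbolic_congr {V W : Type u} [AddCommGroup V] [Module F V] [FiniteDimensional F V]
    [AddCommGroup W] [Module F W] [FiniteDimensional F W] (e : V ≃ₗ[F] W) :
    Isometric (hyperbolic (F := F) V) (hyperbolic W) :=
  ⟨QuadraticForm.dualProdIsometry e⟩

theorem hyperbolic_add (i j : ℕ) :
    Isometric (orthSum (hyperbolic (F := F) (Fin i → F)) (hyperbolic (Fin j → F)))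
      (hyperbolic (Fin (i + j) → F)) :=
  (hyperbolic_prod _ _).trans (hyperbolic_congr (LinearEquiv.ofFinrankEq _ _ (by simp)))

theorem WittEquiv.of_isometric {φ ψ : EvenForm F} (h : Isometric φ ψ) : WittEquiv φ ψ :=
  ⟨0, 0, orthSum_congr h (Isometric.refl _)⟩

theorem WittEquiv.symm {φ ψ : EvenForm F} (h : WittEquiv φ ψ) : WittEquiv ψ φ := by
  obtain ⟨i, j, e⟩ := h
  exact ⟨j, i, e.symm⟩

theorem WittEquiv.trans {φ ψ χ : EvenForm F} (h : WittEquiv φ ψ) (h' : WittEquiv ψ χ) :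
    WittEquiv φ χ := by
  obtain ⟨i, j, e⟩ := h
  obtain ⟨i', j', e'⟩ := h'
  refine ⟨i + i', j' + j, ?_⟩
  refine (orthSum_congr (Isometric.refl φ) (hyperbolic_add i i').symm).trans ?_
  refine (orthSum_assoc _ _ _).symm.trans ?_
  refine (orthSum_congr e (Isometric.refl _)).trans ?_
  refine (orthSum_assoc _ _ _).trans ?_
  refine (orthSum_congr (Isometric.refl ψ) (orthSum_comm _ _)).trans ?_
  refine (orthSum_assoc _ _ _).symm.trans ?_
  refine (orthSum_congr e' (Isometric.refl _)).trans ?_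
  refine (orthSum_assoc _ _ _).trans ?_
  exact orthSum_congr (Isometric.refl χ) (hyperbolic_add j' j)

theorem WittEquiv.orthSum {φ φ' ψ ψ' : EvenForm F} (h : WittEquiv φ φ') (h' : WittEquiv ψ ψ') :
    WittEquiv (orthSum φ ψ) (orthSum φ' ψ') := by
  obtain ⟨i, j, e⟩ := h
  obtain ⟨i', j', e'⟩ := h'
  refine ⟨i + i', j + j', ?_⟩
  refine (orthSum_congr (Isometric.refl _) (hyperbolic_add i i').symm).trans ?_
  refine (orthSum_orthSum_comm _ _ _ _).trans ?_
  refine (orthSum_congr e e').trans ?_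
  refine (orthSum_orthSum_comm _ _ _ _).trans ?_
  exact orthSum_congr (Isometric.refl _) (hyperbolic_add j j')

theorem wittEquiv_orthSum_hyperbolic (φ : EvenForm F) (V : Type u) [AddCommGroup V] [Module F V]
    [FiniteDimensional F V] : WittEquiv (EvenForm.orthSum φ (hyperbolic V)) φ :=
  ⟨0, Module.finrank F V + 0,
    (orthSum_assoc _ _ _).trans (orthSum_congr (Isometric.refl φ)
      ((orthSum_congr (hyperbolic_congr (LinearEquiv.ofFinrankEq _ _ (by simp)))
        (Isometric.refl _)).trans (hyperbolic_add _ 0)))⟩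

/-- `φ ⊥ -φ` is hyperbolic, in every characteristic. -/
theorem orthSum_neg_isometric (φ : EvenForm F) :
    Isometric (orthSum φ (scale (-1) φ)) (hyperbolic φ.carrier) := by
  obtain ⟨B, hB⟩ := LinearMap.BilinMap.toQuadraticMap_surjective (R := F) (M := φ.carrier)
    (N := F) φ.form
  let P : φ.carrier →ₗ[F] Module.Dual F φ.carrier := φ.form.polarBilin
  have hP : Function.Injective P := by
    rw [← LinearMap.ker_eq_bot, LinearMap.ker_eq_bot']
    intro x hx
    exact φ.nonsingular x fun y => by simpa [P] using LinearMap.congr_fun hx y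
  have hPB : ∀ x y, P x y = B x y + B y x := by
    intro x y
    simp only [P, ← hB, QuadraticMap.polarBilin_apply_apply, QuadraticMap.polar,
      LinearMap.BilinMap.toQuadraticMap_apply, map_add, LinearMap.add_apply]
    ring
  let T : φ.carrier × φ.carrier →ₗ[F] Module.Dual F φ.carrier × φ.carrier :=
    LinearMap.prod
      (P ∘ₗ LinearMap.snd F _ _ + B ∘ₗ (LinearMap.fst F _ _ - LinearMap.snd F _ _))
      (LinearMap.fst F _ _ - LinearMap.snd F _ _)
  have hT : Function.Injective T := by
    rw [← LinearMap.ker_eq_bot, LinearMap.ker_eq_bot']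
    rintro ⟨x, y⟩ h
    have h2 : x - y = 0 := congrArg Prod.snd h
    have h1 : P y + B (x - y) = 0 := congrArg Prod.fst h
    rw [h2, map_zero, add_zero] at h1
    have hy : y = 0 := hP (by rw [h1, map_zero])
    rw [hy, sub_zero] at h2
    rw [hy, h2]; rfl
  have hdim : Module.finrank F (φ.carrier × φ.carrier) =
      Module.finrank F (Module.Dual F φ.carrier × φ.carrier) := by
    rw [Module.finrank_prod, Module.finrank_prod, Subspace.dual_finrank_eq]
  refine ⟨{ toLinearEquiv := LinearEquiv.ofInjectiveOfFinrankEq T hT hdim, map_app' := ?_ }⟩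
  rintro ⟨(x : φ.carrier), (y : φ.carrier)⟩
  change P y (x - y) + B (x - y) (x - y) = φ.form x + (((-1 : Fˣ) : F) • φ.form) y
  rw [hPB, ← hB]
  simp only [smul_apply, LinearMap.BilinMap.toQuadraticMap_apply, map_sub,
    LinearMap.sub_apply, Units.val_neg, Units.val_one, smul_eq_mul]
  ring

theorem WittEquiv.orthSum_neg_left (φ ψ : EvenForm F) :
    WittEquiv (EvenForm.orthSum ψ (EvenForm.orthSum φ (scale (-1) φ))) ψ :=
  (WittEquiv.of_isometric (orthSum_congr (Isometric.refl ψ) (orthSum_neg_isometric φ))).trans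
    (wittEquiv_orthSum_hyperbolic ψ _)

theorem WittEquiv.neg {φ ψ : EvenForm F} (h : WittEquiv φ ψ) :
    WittEquiv (scale (-1) φ) (scale (-1) ψ) := by
  refine (WittEquiv.orthSum_neg_left ψ _).symm.trans ?_
  refine (WittEquiv.orthSum (.of_isometric (Isometric.refl _))
    (WittEquiv.orthSum h.symm (.of_isometric (Isometric.refl _)))).trans ?_
  refine (WittEquiv.of_isometric ?_).trans (WittEquiv.orthSum_neg_left φ _)
  refine (orthSum_assoc _ _ _).symm.trans ?_
  refine (orthSum_comm _ _).trans ?_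
  exact orthSum_congr (Isometric.refl _) (orthSum_comm _ _)

instance wittSetoid (F : Type u) [Field F] : Setoid (EvenForm F) where
  r := WittEquiv
  iseqv := ⟨fun φ => .of_isometric (Isometric.refl φ), WittEquiv.symm, WittEquiv.trans⟩

end EvenForm

/-- The Witt group `I_q^1 F` of even-dimensional nonsingular quadratic forms over `F`. -/
def WittGroup (F : Type u) [Field F] : Type (u + 1) := Quotient (EvenForm.wittSetoid F)

namespace EvenForm

variable {F : Type u} [Field F]

/-- The Witt class of a form. -/
def wittClass (φ : EvenForm F) : WittGroup F := Quotient.mk _ φ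

end EvenForm

namespace WittGroup

variable {F : Type u} [Field F]

open EvenForm

instance : Add (WittGroup F) :=
  ⟨Quotient.map₂ orthSum fun _ _ h _ _ h' => WittEquiv.orthSum h h'⟩

instance : Zero (WittGroup F) := ⟨wittClass (hyperbolic (Fin 0 → F))⟩

instance : Neg (WittGroup F) := ⟨Quotient.map (scale (-1)) fun _ _ h => WittEquiv.neg h⟩

/-- The group structure of `I_q^1 F`, induced by orthogonal sum. -/
instance : AddCommGroup (WittGroup F) where
  add_assoc := by
    rintro ⟨a⟩ ⟨b⟩ ⟨c⟩
    exact Quotient.sound (WittEquiv.of_isometric (orthSum_assoc a b c))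
  add_comm := by
    rintro ⟨a⟩ ⟨b⟩
    exact Quotient.sound (WittEquiv.of_isometric (orthSum_comm a b))
  zero_add := by
    rintro ⟨a⟩
    exact Quotient.sound ((WittEquiv.of_isometric (orthSum_comm _ a)).trans
      (wittEquiv_orthSum_hyperbolic a _))
  add_zero := by
    rintro ⟨a⟩
    exact Quotient.sound (wittEquiv_orthSum_hyperbolic a _)
  neg_add_cancel := by
    rintro ⟨a⟩
    refine Quotient.sound (WittEquiv.symm ?_)
    refine (WittEquiv.orthSum_neg_left a _).symm.trans (WittEquiv.of_isometric ?_ |>.trans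
      (wittEquiv_orthSum_hyperbolic _ (Fin 0 → F)))
    exact (orthSum_comm _ _).trans (orthSum_congr (orthSum_comm _ _) (Isometric.refl _))
  nsmul := nsmulRec
  zsmul := zsmulRec

end WittGroup

namespace EvenForm

variable {F : Type u} [Field F]

/-- The binary form `[1, α] : (u₁, u₂) ↦ u₁² + u₁ u₂ + α u₂²`; it is nonsingular exactly when
`4 α ≠ 1`, which is automatic in characteristic two. It is the quadratic `1`-fold Pfister form
`⟨⟨α]]`. -/
def binary (α : F) (hα : 4 * α ≠ 1) : EvenForm F where
  carrier := F × F
  form := QuadraticMap.sq.comp (LinearMap.fst F F F) +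
    QuadraticMap.linMulLin (LinearMap.fst F F F) (LinearMap.snd F F F) +
    α • QuadraticMap.sq.comp (LinearMap.snd F F F)
  nonsingular := by
    rintro ⟨x, y⟩ h
    have h1 := h (1, 0)
    have h2 := h (0, 1)
    simp [QuadraticMap.polar] at h1 h2
    have e1 : 2 * x + y = 0 := by linear_combination h1
    have e2 : x + 2 * α * y = 0 := by linear_combination h2
    have hy : (4 * α - 1) * y = 0 := by linear_combination 2 * e2 - e1
    have hy0 : y = 0 := (mul_eq_zero.mp hy).resolve_left (sub_ne_zero.mpr hα)
    have hx0 : x = 0 := by rw [hy0] at e2; linear_combination e2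
    rw [hx0, hy0]; rfl
  even_dim := by
    rw [Module.finrank_prod]
    exact ⟨_, rfl⟩

/-- The product `⟨⟨β₁, …, βₘ⟩⟩ ⊗ φ` of a bilinear Pfister form with a quadratic form, where
`⟨⟨β₁, …, βₘ⟩⟩ = ⟨1, β₁⟩ ⊗ ⋯ ⊗ ⟨1, βₘ⟩` and `⟨1, β⟩ ⊗ φ = φ ⊥ β φ`. -/
def pfisterMul : List Fˣ → EvenForm F → EvenForm F
  | [], φ => φ
  | β :: l, φ => orthSum (pfisterMul l φ) (scale β (pfisterMul l φ))

/-- `φ` is (isometric to) a quadratic `n`-fold Pfister form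
`⟨⟨β₁, …, βₙ₋₁, α]] = ⟨⟨β₁, …, βₙ₋₁⟩⟩ ⊗ [1, α]`; such forms exist only for `n ≥ 1`. -/
def IsPfister (n : ℕ) (φ : EvenForm F) : Prop :=
  ∃ (l : List Fˣ) (α : F) (hα : 4 * α ≠ 1),
    l.length + 1 = n ∧ Isometric φ (pfisterMul l (binary α hα))

/-- `φ` is a right divisor of `ψ` with an `m`-fold bilinear Pfister cofactor:
`ψ ≅ b ⊗ φ` for a bilinear `m`-fold Pfister form `b`. -/
def IsRightDivisor (m : ℕ) (φ ψ : EvenForm F) : Prop :=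
  ∃ l : List Fˣ, l.length = m ∧ Isometric ψ (pfisterMul l φ)

/-- A set of quadratic `n`-fold Pfister forms is right-linked if some quadratic `(n - 1)`-fold
Pfister form is a right divisor of all its elements. -/
def RightLinked (n : ℕ) (S : Set (EvenForm F)) : Prop :=
  ∃ φ : EvenForm F, IsPfister (n - 1) φ ∧ ∀ ψ ∈ S, IsRightDivisor 1 φ ψ

end EvenForm

open EvenForm

/-- `I_q^n F` (for `n ≥ 1`): the subgroup of `I_q^1 F` generated by the scalar multiples of
quadratic `n`-fold Pfister forms. -/
def Iq (F : Type u) [Field F] (n : ℕ) : AddSubgroup (WittGroup F) :=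
  AddSubgroup.closure {w | ∃ (a : Fˣ) (φ : EvenForm F), IsPfister n φ ∧ w = (scale a φ).wittClass}

/-- The quotient `I_q^n F / I_q^{n+1} F`. -/
abbrev IqQuot (F : Type u) [Field F] (n : ℕ) : Type (u + 1) :=
  Iq F n ⧸ (Iq F (n + 1)).addSubgroupOf (Iq F n)

variable {F : Type u} [Field F]

/-- `x ∈ I_q^n F` is the Witt class of an `n`-fold Pfister form representing the element `g` of
`I_q^n F / I_q^{n+1} F`. -/
def IsPfisterRep (n : ℕ) (g : IqQuot F n) (x : Iq F n) : Prop :=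
  (∃ φ : EvenForm F, IsPfister n φ ∧ φ.wittClass = x) ∧ (QuotientAddGroup.mk x : IqQuot F n) = g

open Classical in
/-- The Pfister representative (as an element of `I_q^n F`) of `g ∈ I_q^n F / I_q^{n+1} F`; the
value is `0` if there is none. -/
def pfisterRep (n : ℕ) (g : IqQuot F n) : Iq F n :=
  if h : ∃ x, IsPfisterRep n g x then h.choose else 0

/-- The subgroup of `I_q^n F / I_q^{n+1} F` generated by the image of a set `S` of `n`-fold Pfister
forms. -/
def generatedGroup (n : ℕ) (S : Set (EvenForm F)) : AddSubgroup (IqQuot F n) :=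
  AddSubgroup.closure
    {g | ∃ x : Iq F n, (∃ ψ ∈ S, ψ.wittClass = x) ∧ (QuotientAddGroup.mk x : IqQuot F n) = g}

/-- The invariant `Σ_S`: the sum in `I_q^n F` of the Pfister representatives of the elements of the
group generated by `S` in `I_q^n F / I_q^{n+1} F`. -/
def sigmaInvariant (n : ℕ) (S : Set (EvenForm F)) : Iq F n :=
  ∑ᶠ g : generatedGroup n S, pfisterRep n (g : IqQuot F n)

end

/-!
The substance of the theorem is the uniqueness of Pfister representatives: two `n`-fold Pfister
forms that agree modulo `I_q^{n+1}` have the same Witt class. This follows from the Arason–Pfister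
Hauptsatz (`wittClass_eq_zero_of_mem_Iq`): a form of dimension less than `2 ^ m` whose class lies in
`I_q^m` is zero in the Witt group. The difference of the two Pfister forms is isotropic of dimension
`2 ^ (n + 1)`, hence has the class of a form of smaller dimension.

The Hauptsatz is proved by induction on the number of scaled Pfister forms that add up to the given
class, over all fields at once. The inductive step needs a field extension that makes one summand
`π` hyperbolic, but not the given anisotropic form `q`, and it exists unless `dim q ≥ dim π`
(`finrank_le_of_forall_scalarExt`). Instead of the function field of `π`, all quadratic extensions
`E(θ)` of all extensions `E` of `F` are used in which `π` acquires a zero `θ v₀ + x`. If `q` always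
becomes hyperbolic there, then writing the vectors of a Lagrangian as `v + θ w` shows that `q`
represents `a π(x)` for every vector `x` over every `E` over which `q` stays anisotropic, where `a`
is a fixed value of `q` (`exists_quadEval_eq_mul`). By the Cassels–Pfister theorem (`exists_polynomial_quadEval_eq`) and
reflections, a form with this property contains `a π` (`card_le_card_of_represents`). Pfister forms
enter through roundness (`IsPfister.isRound`): isotropic Pfister forms are hyperbolic. The
characteristic is arbitrary throughout, since forms are handled through matrices that need not be
symmetric, and the vanishing of a Witt class is detected by a Lagrangian subspace
(`wittClass_eq_zero_iff`).

Given uniqueness, let `φ` be the common divisor. The Witt group has exponent two by the assumption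
on `-1`, so `β ↦ ⟨⟨β⟩⟩ ⊗ φ` is a homomorphism from `Fˣ` to `I_q^n / I_q^{n+1}` (`pfisterMulHom`),
and the generated group lies in its image. For `β₁, …, βₛ` over a basis of the group, the
representatives are the classes `φ + (∏_{i ∈ T} βᵢ) φ`. The `2 ^ s` copies of `φ` cancel when
`s ≥ 1`, and the other summands are the expansion of `⟨⟨β₁, …, βₛ⟩⟩ ⊗ φ = ∏ (1 + βᵢ) φ`.
-/

/-! ### Lagrangians and the zero Witt class -/

namespace EvenForm

variable {F : Type u} [Field F]

/-- `W` is totally isotropic of at least half the dimension. Since the form is nonsingular, the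
dimension is then exactly half. -/
def IsLagrangian (φ : EvenForm F) (W : Submodule F φ.carrier) : Prop :=
  (∀ x ∈ W, φ.form x = 0) ∧ Module.finrank F φ.carrier ≤ 2 * Module.finrank F W

theorem polar_eq_zero_of_totallyIsotropic {φ : EvenForm F} {W : Submodule F φ.carrier}
    (hW : ∀ x ∈ W, φ.form x = 0) {x y : φ.carrier} (hx : x ∈ W) (hy : y ∈ W) :
    QuadraticMap.polar φ.form x y = 0 := by
  simp [QuadraticMap.polar, hW _ hx, hW _ hy, hW _ (W.add_mem hx hy)]

theorem finrank_orthSum (φ ψ : EvenForm F) : Module.finrank F (orthSum φ ψ).carrier =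
    Module.finrank F φ.carrier + Module.finrank F ψ.carrier :=
  Module.finrank_prod

theorem finrank_scale (a : Fˣ) (φ : EvenForm F) :
    Module.finrank F (scale a φ).carrier = Module.finrank F φ.carrier := rfl

theorem finrank_hyperbolic (V : Type u) [AddCommGroup V] [Module F V] [FiniteDimensional F V] :
    Module.finrank F (hyperbolic (F := F) V).carrier =
      Module.finrank F V + Module.finrank F V :=
  (Module.finrank_prod (R := F) (M := Module.Dual F V) (M' := V)).trans
    (by rw [Subspace.dual_finrank_eq])

theorem isLagrangian_range {φ : EvenForm F} {U : Type*} [AddCommGroup U] [Module F U]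
    (T : U →ₗ[F] φ.carrier) (hT : Function.Injective T) (h : ∀ u, φ.form (T u) = 0)
    (hd : Module.finrank F φ.carrier ≤ 2 * Module.finrank F U) :
    φ.IsLagrangian (LinearMap.range T) :=
  ⟨by rintro _ ⟨u, rfl⟩; exact h u, by rwa [LinearMap.finrank_range_of_inj hT]⟩

/-- If `V = W ⊕ M` with `W` a Lagrangian, the polar form identifies `W` with the dual of `M`, and
the form becomes hyperbolic after `M` is moved along `W` to a second totally isotropic subspace. -/
theorem IsLagrangian.exists_isometric_hyperbolic {φ : EvenForm F} {W : Submodule F φ.carrier}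
    (hW : φ.IsLagrangian W) : ∃ M : Submodule F φ.carrier, Isometric φ (hyperbolic M) := by
  obtain ⟨B, hB⟩ := LinearMap.BilinMap.toQuadraticMap_surjective (R := F) (M := φ.carrier)
    (N := F) φ.form
  obtain ⟨M, hM⟩ := Submodule.exists_isCompl W
  have hdim := Submodule.finrank_add_eq_of_isCompl hM
  refine ⟨M, Isometric.symm ?_⟩
  let P : W →ₗ[F] Module.Dual F M :=
    (φ.form.polarBilin.domRestrict W).compl₂ M.subtype
  have hPv : ∀ w m, P w m = QuadraticMap.polar φ.form w m := fun w m => rfl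
  have hP : Function.Injective P := by
    rw [← LinearMap.ker_eq_bot, LinearMap.ker_eq_bot']
    intro w hw
    refine Subtype.ext (φ.nonsingular w fun y => ?_)
    obtain ⟨a, ha, b, hb, rfl⟩ :=
      Submodule.mem_sup.mp (hM.sup_eq_top ▸ Submodule.mem_top : y ∈ W ⊔ M)
    rw [QuadraticMap.polar_add_right, polar_eq_zero_of_totallyIsotropic hW.1 w.2 ha, zero_add]
    exact LinearMap.congr_fun hw ⟨b, hb⟩
  have hle := LinearMap.finrank_le_finrank_of_injective hP
  rw [Subspace.dual_finrank_eq] at hle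
  have hWM : Module.finrank F W = Module.finrank F M := by have := hW.2; omega
  let κ : Module.Dual F M ≃ₗ[F] W := (LinearEquiv.ofInjectiveOfFinrankEq P hP
    (by rw [Subspace.dual_finrank_eq, hWM])).symm
  have hκ : ∀ (f : Module.Dual F M) (m : M), QuadraticMap.polar φ.form (κ f) m = f m := by
    intro f m
    rw [← hPv]
    exact LinearMap.congr_fun ((LinearEquiv.ofInjectiveOfFinrankEq P hP _).apply_symm_apply f) m
  let D : M →ₗ[F] Module.Dual F M := (B.domRestrict M).compl₂ M.subtype
  have hD : ∀ m, D m m = φ.form m := by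
    intro m
    rw [← hB]; rfl
  let T : Module.Dual F M × M →ₗ[F] φ.carrier :=
    W.subtype ∘ₗ κ.toLinearMap ∘ₗ (LinearMap.fst F _ _ - D ∘ₗ LinearMap.snd F _ _) +
      M.subtype ∘ₗ LinearMap.snd F _ _
  have hTv : ∀ f m, T (f, m) = (κ (f - D m) : φ.carrier) + m := fun f m => rfl
  have hT : Function.Injective T := by
    rw [← LinearMap.ker_eq_bot, LinearMap.ker_eq_bot']
    rintro ⟨f, m⟩ h
    rw [hTv] at h
    have hm : (m : φ.carrier) ∈ W := by
      rw [eq_neg_of_add_eq_zero_right h]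
      exact W.neg_mem (κ _).2
    have hm0 : m = 0 := Subtype.ext (Submodule.disjoint_def.mp hM.disjoint _ hm m.2)
    rw [hm0] at h ⊢
    simpa using h
  refine ⟨{ toLinearEquiv := LinearEquiv.ofInjectiveOfFinrankEq T hT ?_, map_app' := ?_ }⟩
  · rw [finrank_hyperbolic]; omega
  · rintro ⟨f, m⟩
    change φ.form (T (f, m)) = f m
    rw [hTv, QuadraticMap.map_add φ.form, hW.1 _ (κ _).2, hκ, ← hD]
    simp

theorem wittClass_hyperbolic (V : Type u) [AddCommGroup V] [Module F V] [FiniteDimensional F V] :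
    (hyperbolic (F := F) V).wittClass = 0 := by
  refine Quotient.sound ?_
  exact (wittEquiv_orthSum_hyperbolic _ (Fin 0 → F)).symm.trans
    ((WittEquiv.of_isometric (orthSum_comm _ _)).trans (wittEquiv_orthSum_hyperbolic _ V))

theorem Isometric.wittClass_eq {φ ψ : EvenForm F} (h : Isometric φ ψ) :
    φ.wittClass = ψ.wittClass :=
  Quotient.sound (WittEquiv.of_isometric h)

theorem IsLagrangian.wittClass_eq_zero {φ : EvenForm F} {W : Submodule F φ.carrier}
    (hW : φ.IsLagrangian W) : φ.wittClass = 0 := by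
  obtain ⟨M, hM⟩ := hW.exists_isometric_hyperbolic
  rw [hM.wittClass_eq, wittClass_hyperbolic]

theorem IsLagrangian.map {φ ψ : EvenForm F} {W : Submodule F φ.carrier}
    (hW : φ.IsLagrangian W) (e : φ.form.IsometryEquiv ψ.form) :
    ψ.IsLagrangian (W.map e.toLinearEquiv.toLinearMap) := by
  refine ⟨?_, ?_⟩
  · rintro _ ⟨x, hx, rfl⟩
    exact (e.map_app x).trans (hW.1 x hx)
  · have h1 := e.toLinearEquiv.finrank_eq
    have h2 := LinearEquiv.finrank_map_eq e.toLinearEquiv W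
    rw [← h1]
    refine hW.2.trans_eq ?_
    rw [← h2]

theorem exists_isLagrangian_hyperbolic (V : Type u) [AddCommGroup V] [Module F V]
    [FiniteDimensional F V] : ∃ W, (hyperbolic (F := F) V).IsLagrangian W := by
  refine ⟨_, isLagrangian_range (φ := hyperbolic V) (LinearMap.inr F (Module.Dual F V) V)
    LinearMap.inr_injective (fun v => ?_) ?_⟩
  · change (0 : Module.Dual F V) v = 0
    rfl
  · rw [finrank_hyperbolic]; omega

/-- A totally isotropic subspace of the orthogonal sum of `Q` and the hyperbolic form on `V* × V`,
given as the image of `T`, induces one of `Q`, of dimension smaller by at most `dim V`: intersect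
with the orthogonal complement of the Lagrangian `V*` and project. -/
theorem exists_totallyIsotropic_of_prod_dualProd {U V X : Type*} [AddCommGroup U] [Module F U]
    [FiniteDimensional F U] [AddCommGroup V] [Module F V] [FiniteDimensional F V]
    [AddCommGroup X] [Module F X] [FiniteDimensional F X]
    (Q : QuadraticForm F U) (T : X →ₗ[F] U × (Module.Dual F V × V)) (hT : Function.Injective T)
    (hX : ∀ x, Q (T x).1 + (T x).2.1 (T x).2.2 = 0) :
    ∃ W' : Submodule F U, (∀ x ∈ W', Q x = 0) ∧
      Module.finrank F X ≤ Module.finrank F W' + Module.finrank F V := by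
  let A : X →ₗ[F] V := (LinearMap.snd F _ _ ∘ₗ LinearMap.snd F _ _) ∘ₗ T
  let C : LinearMap.ker A →ₗ[F] U := (LinearMap.fst F _ _ ∘ₗ T) ∘ₗ (LinearMap.ker A).subtype
  let D : LinearMap.ker C →ₗ[F] Module.Dual F V :=
    ((LinearMap.fst F _ _ ∘ₗ LinearMap.snd F _ _) ∘ₗ T) ∘ₗ (LinearMap.ker A).subtype ∘ₗ
      (LinearMap.ker C).subtype
  have hA : ∀ x : LinearMap.ker A, (T x).2.2 = 0 := fun x => x.2
  have hC : ∀ x : LinearMap.ker C, (T x).1 = 0 := fun x => x.2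
  have hD : ∀ x, D x ∈ (LinearMap.range A).dualAnnihilator := by
    intro x
    rw [Submodule.mem_dualAnnihilator]
    rintro _ ⟨y, rfl⟩
    change (T x).2.1 (T y).2.2 = 0
    have h1 := hX (x + y)
    have h2 := hX y
    have h3 := hC x
    have h4 := hA x.1
    simp only [map_add, Prod.fst_add, Prod.snd_add, h3, h4, zero_add, LinearMap.add_apply] at h1
    linear_combination h1 - h2
  have hDi : Function.Injective (D.codRestrict _ hD) := by
    intro x y hxy
    have h1 : (T x).2.1 = (T y).2.1 := congrArg Subtype.val hxy
    exact Subtype.ext (Subtype.ext (hT (Prod.ext ((hC x).trans (hC y).symm)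
      (Prod.ext h1 ((hA x.1).trans (hA y.1).symm)))))
  refine ⟨LinearMap.range C, ?_, ?_⟩
  · rintro _ ⟨x, rfl⟩
    have h1 := hX x.1
    rw [hA, map_zero, add_zero] at h1
    exact h1
  · have e1 := LinearMap.finrank_range_add_finrank_ker A
    have e2 := LinearMap.finrank_range_add_finrank_ker C
    have e3 := LinearMap.finrank_le_finrank_of_injective hDi
    have e4 := Subspace.finrank_add_finrank_dualAnnihilator_eq (LinearMap.range A)
    omega

theorem IsLagrangian.of_orthSum_hyperbolic {φ : EvenForm F} {V : Type u} [AddCommGroup V]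
    [Module F V] [FiniteDimensional F V] {W : Submodule F (orthSum φ (hyperbolic V)).carrier}
    (hW : (orthSum φ (hyperbolic V)).IsLagrangian W) : ∃ W', φ.IsLagrangian W' := by
  obtain ⟨W', h1, h2⟩ := exists_totallyIsotropic_of_prod_dualProd (V := V) φ.form W.subtype
    W.subtype_injective (fun x => hW.1 x x.2)
  refine ⟨W', h1, ?_⟩
  have h3 := hW.2
  rw [finrank_orthSum, finrank_hyperbolic] at h3
  exact (by omega : ∀ a b c w : ℕ, w ≤ a + b → c + (b + b) ≤ 2 * w → c ≤ 2 * a) _ _ _ _ h2 h3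

theorem wittClass_eq_zero_iff {φ : EvenForm F} :
    φ.wittClass = 0 ↔ ∃ W, φ.IsLagrangian W := by
  refine ⟨fun h => ?_, fun ⟨W, hW⟩ => hW.wittClass_eq_zero⟩
  obtain ⟨i, j, ⟨e⟩⟩ : WittEquiv φ (hyperbolic (Fin 0 → F)) := Quotient.exact h
  obtain ⟨e'⟩ := hyperbolic_add (F := F) 0 j
  obtain ⟨W, hW⟩ := exists_isLagrangian_hyperbolic (F := F) (Fin (0 + j) → F)
  exact ((hW.map e'.symm).map e.symm).of_orthSum_hyperbolic

theorem wittClass_orthSum (φ ψ : EvenForm F) :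
    (orthSum φ ψ).wittClass = φ.wittClass + ψ.wittClass := rfl

theorem wittClass_scale_neg_one (φ : EvenForm F) :
    (scale (-1) φ).wittClass = -φ.wittClass := rfl

theorem wittClass_eq_iff {φ ψ : EvenForm F} :
    φ.wittClass = ψ.wittClass ↔ ∃ W, (orthSum φ (scale (-1) ψ)).IsLagrangian W := by
  rw [← wittClass_eq_zero_iff, wittClass_orthSum, wittClass_scale_neg_one, add_neg_eq_zero]

/-! ### Reduction to anisotropic forms -/

/-- An isotropic form has the Witt class of a form of smaller dimension, namely of the orthogonal
complement of a hyperbolic plane. -/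
theorem exists_wittClass_eq_of_isotropic {φ : EvenForm F} {v : φ.carrier} (hv : v ≠ 0)
    (hv0 : φ.form v = 0) : ∃ ψ : EvenForm F, ψ.wittClass = φ.wittClass ∧
      Module.finrank F ψ.carrier + 2 = Module.finrank F φ.carrier := by
  obtain ⟨w, hvw, hw0⟩ : ∃ w, QuadraticMap.polar φ.form v w = 1 ∧ φ.form w = 0 := by
    obtain ⟨y, hy⟩ : ∃ y, QuadraticMap.polar φ.form v y ≠ 0 := by
      by_contra! h
      exact hv (φ.nonsingular v h)
    set c := QuadraticMap.polar φ.form v y with hc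
    have h1 : QuadraticMap.polar φ.form v (c⁻¹ • y) = 1 := by
      rw [QuadraticMap.polar_smul_right, ← hc, smul_eq_mul, inv_mul_cancel₀ hy]
    generalize c⁻¹ • y = z at h1
    refine ⟨z - φ.form z • v, ?_, ?_⟩
    · rw [QuadraticMap.polar_sub_right, QuadraticMap.polar_smul_right, h1,
        QuadraticMap.polar_self, hv0]
      simp
    · rw [sub_eq_add_neg, QuadraticMap.map_add φ.form, ← neg_smul,
        QuadraticMap.map_smul, hv0, QuadraticMap.polar_smul_right, QuadraticMap.polar_comm, h1]
      simp
  let b := φ.form.polarBilin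
  have hb : ∀ x y, b x y = QuadraticMap.polar φ.form x y := fun _ _ => rfl
  have hvv : b v v = 0 := by rw [hb, QuadraticMap.polar_self, hv0, smul_zero]
  have hww : b w w = 0 := by rw [hb, QuadraticMap.polar_self, hw0, smul_zero]
  have hwv : b w v = 1 := by rw [hb, QuadraticMap.polar_comm, hvw]
  have hvw' : b v w = 1 := hvw
  let R : φ.carrier →ₗ[F] F × F := (b v).prod (b w)
  have hR : LinearMap.range R = ⊤ := by
    rw [LinearMap.range_eq_top]
    rintro ⟨s, t⟩
    refine ⟨s • w + t • v, ?_⟩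
    simp [R, hvv, hww, hwv, hvw']
  let U := LinearMap.ker R
  have hU : ∀ x : U, b v x = 0 ∧ b w x = 0 := fun x => by
    have h : R x = 0 := x.2
    exact ⟨congrArg Prod.fst h, congrArg Prod.snd h⟩
  have hdim : Module.finrank F U + 2 = Module.finrank F φ.carrier := by
    have h := LinearMap.finrank_range_add_finrank_ker R
    rw [hR, finrank_top, Module.finrank_prod, Module.finrank_self] at h
    change 1 + 1 + Module.finrank F U = _ at h
    omega
  let ψ : EvenForm F :=
    { carrier := U
      form := φ.form.comp U.subtype
      nonsingular := by
        intro x hx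
        refine Subtype.ext (φ.nonsingular x fun y => ?_)
        have hz : y - b w y • v - b v y • w ∈ U := by
          change R _ = 0
          simp [R, hvv, hww, hwv, hvw']
        have h1 : b x (y - b w y • v - b v y • w) = 0 := hx ⟨_, hz⟩
        have h2 : b x v = 0 := by
          rw [hb, QuadraticMap.polar_comm]; exact (hU x).1
        have h3 : b x w = 0 := by
          rw [hb, QuadraticMap.polar_comm]; exact (hU x).2
        rw [map_sub, map_sub, map_smul, map_smul, h2, h3, smul_zero, smul_zero, sub_zero,
          sub_zero] at h1
        exact h1
      even_dim := by
        have := φ.even_dim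
        rw [← hdim] at this
        exact (Nat.even_add.mp this).mpr even_two }
  refine ⟨ψ, ?_, hdim⟩
  rw [eq_comm, wittClass_eq_iff]
  let T : F × U →ₗ[F] φ.carrier × U :=
    LinearMap.prod ((LinearMap.toSpanSingleton F _ v).coprod U.subtype) (LinearMap.snd F _ _)
  have hT : Function.Injective T := by
    rw [← LinearMap.ker_eq_bot, LinearMap.ker_eq_bot']
    rintro ⟨c, x⟩ h
    have h2 : x = 0 := congrArg Prod.snd h
    have h1 : c • v + (x : φ.carrier) = 0 := congrArg Prod.fst h
    rw [h2] at h1 ⊢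
    have h3 : c = 0 := by simpa [hv] using h1
    rw [h3]; rfl
  refine ⟨_, isLagrangian_range (φ := orthSum φ (scale (-1) ψ)) T hT ?_ ?_⟩
  · rintro ⟨c, x⟩
    change φ.form (c • v + (x : φ.carrier)) + ((-1 : Fˣ) : F) * φ.form x = 0
    have h := (hU x).1
    rw [hb] at h
    rw [QuadraticMap.map_add φ.form, QuadraticMap.map_smul, hv0, QuadraticMap.polar_smul_left, h]
    simp
  · rw [finrank_orthSum, finrank_scale, Module.finrank_prod, Module.finrank_self]
    change _ + Module.finrank F U ≤ _
    omega

/-- Every Witt class contains an anisotropic form, of dimension at most that of a given form. -/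
theorem exists_anisotropic (φ : EvenForm F) : ∃ ψ : EvenForm F, ψ.wittClass = φ.wittClass ∧
    Module.finrank F ψ.carrier ≤ Module.finrank F φ.carrier ∧ ∀ x, ψ.form x = 0 → x = 0 := by
  induction h : Module.finrank F φ.carrier using Nat.strong_induction_on generalizing φ with
  | _ d ih =>
    by_cases hφ : ∀ x, φ.form x = 0 → x = 0
    · exact ⟨φ, rfl, h.le, hφ⟩
    · push Not at hφ
      obtain ⟨v, hv0, hv⟩ := hφ
      obtain ⟨ψ, hψ, hd⟩ := exists_wittClass_eq_of_isotropic hv hv0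
      obtain ⟨χ, hχ, hd', han⟩ := ih _ (by omega) ψ rfl
      exact ⟨χ, hχ.trans hψ, by omega, han⟩

end EvenForm

/-! ### Scaling Witt classes -/

namespace EvenForm

variable {F : Type u} [Field F]

theorem scale_orthSum (a : Fˣ) (φ ψ : EvenForm F) :
    Isometric (scale a (orthSum φ ψ)) (orthSum (scale a φ) (scale a ψ)) :=
  ⟨{ toLinearEquiv := LinearEquiv.refl F (φ.carrier × ψ.carrier)
     map_app' := fun x => (mul_add (a : F) (φ.form x.1) (ψ.form x.2)).symm }⟩

theorem scale_scale (a b : Fˣ) (φ : EvenForm F) :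
    Isometric (scale a (scale b φ)) (scale (a * b) φ) :=
  ⟨{ toLinearEquiv := LinearEquiv.refl F φ.carrier
     map_app' := fun x => mul_assoc (a : F) b (φ.form x) }⟩

theorem scale_one (φ : EvenForm F) : Isometric (scale 1 φ) φ :=
  ⟨{ toLinearEquiv := LinearEquiv.refl F φ.carrier
     map_app' := fun x => (one_mul (φ.form x)).symm }⟩

theorem scale_congr (a : Fˣ) {φ ψ : EvenForm F} (h : Isometric φ ψ) :
    Isometric (scale a φ) (scale a ψ) := by
  obtain ⟨e⟩ := h
  exact ⟨{ toLinearEquiv := e.toLinearEquiv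
           map_app' := fun x => congrArg ((a : F) * ·) (e.map_app x) }⟩

theorem IsLagrangian.scale (a : Fˣ) {φ : EvenForm F} {W : Submodule F φ.carrier}
    (hW : φ.IsLagrangian W) : (EvenForm.scale a φ).IsLagrangian W :=
  ⟨fun x hx => (congrArg ((a : F) * ·) (hW.1 x hx)).trans (mul_zero _), hW.2⟩

theorem wittEquiv_iff {φ ψ : EvenForm F} : WittEquiv φ ψ ↔ φ.wittClass = ψ.wittClass :=
  ⟨fun h => Quotient.sound h, fun h => Quotient.exact h⟩

theorem WittEquiv.scale (a : Fˣ) {φ ψ : EvenForm F} (h : WittEquiv φ ψ) :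
    WittEquiv (scale a φ) (scale a ψ) := by
  obtain ⟨W, hW⟩ := wittClass_eq_iff.mp (wittEquiv_iff.mp h)
  have h1 := (hW.scale a).wittClass_eq_zero
  rw [(scale_orthSum a _ _).wittClass_eq, wittClass_orthSum, (scale_scale a (-1) ψ).wittClass_eq,
    mul_comm, ← (scale_scale (-1) a ψ).wittClass_eq, wittClass_scale_neg_one, add_neg_eq_zero] at h1
  exact wittEquiv_iff.mpr h1

end EvenForm

namespace WittGroup

open EvenForm

variable {F : Type u} [Field F]

/-- The action of the units of `F` on the Witt group by scaling of forms. -/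
noncomputable def scaleHom : Fˣ →* AddMonoid.End (WittGroup F) where
  toFun a :=
    { toFun := Quotient.map (scale a) fun _ _ h => WittEquiv.scale a h
      map_zero' := by
        obtain ⟨W, hW⟩ := exists_isLagrangian_hyperbolic (F := F) (Fin 0 → F)
        exact (hW.scale a).wittClass_eq_zero
      map_add' := by
        rintro ⟨φ⟩ ⟨ψ⟩
        exact (scale_orthSum a φ ψ).wittClass_eq }
  map_one' := by
    ext ⟨φ⟩
    exact (scale_one φ).wittClass_eq
  map_mul' a b := by
    ext ⟨φ⟩
    exact (scale_scale a b φ).wittClass_eq.symm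

theorem scaleHom_wittClass (a : Fˣ) (φ : EvenForm F) :
    scaleHom a φ.wittClass = (scale a φ).wittClass := rfl

theorem scaleHom_neg_one (x : WittGroup F) : scaleHom (-1) x = -x := by
  obtain ⟨φ⟩ := x
  rfl

theorem scaleHom_scaleHom (a b : Fˣ) (x : WittGroup F) :
    scaleHom a (scaleHom b x) = scaleHom (a * b) x := by
  rw [map_mul]; rfl

theorem scaleHom_one (x : WittGroup F) : scaleHom 1 x = x := by
  rw [map_one]; rfl

theorem scaleHom_mul_self (a : Fˣ) (x : WittGroup F) : scaleHom (a * a) x = x := by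
  obtain ⟨φ⟩ := x
  refine Isometric.wittClass_eq ⟨{ toLinearEquiv := LinearEquiv.smulOfUnit (M := φ.carrier) a
                                   map_app' := fun x => ?_ }⟩
  exact φ.form.map_smul (a : F) x

end WittGroup

/-! ### Pfister forms are round -/

namespace EvenForm

open WittGroup

variable {F : Type u} [Field F]

/-- The two basic properties of Pfister forms: the form is hyperbolic as soon as it is isotropic,
and it does not change when scaled by one of its nonzero values; both are stated for Witt
classes. -/
def IsRound (φ : EvenForm F) : Prop :=
  (∀ x, x ≠ 0 → φ.form x = 0 → φ.wittClass = 0) ∧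
    ∀ (c : Fˣ) (x), φ.form x = c → scaleHom c φ.wittClass = φ.wittClass

theorem binary_form (α : F) (hα : 4 * α ≠ 1) (x : F × F) :
    (binary α hα).form x = x.1 * x.1 + x.1 * x.2 + α * (x.2 * x.2) := rfl

theorem finrank_binary (α : F) (hα : 4 * α ≠ 1) :
    Module.finrank F (binary α hα).carrier = 2 := by
  change Module.finrank F (F × F) = 2
  rw [Module.finrank_prod, Module.finrank_self]

/-- `[1, α]` is the norm form of the quadratic algebra `F[θ]/(θ² - θ + α)`, hence
multiplicative. -/
theorem isRound_binary (α : F) (hα : 4 * α ≠ 1) : IsRound (binary α hα) := by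
  refine ⟨fun x hx h => ?_, ?_⟩
  · refine (isLagrangian_range (φ := binary α hα) (LinearMap.toSpanSingleton F (F × F) x)
      ?_ (fun c => ?_) ?_).wittClass_eq_zero
    · exact smul_left_injective F hx
    · have h1 := (binary α hα).form.map_smul c x
      rw [h, smul_zero] at h1
      exact h1
    · rw [finrank_binary, Module.finrank_self]
  · rintro c ⟨a, b⟩ h
    rw [binary_form] at h
    change a * a + a * b + α * (b * b) = c at h
    -- multiplication by `a + b θ`
    let T : F × F →ₗ[F] F × F :=
      LinearMap.prod (a • LinearMap.fst F F F - (α * b) • LinearMap.snd F F F)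
        (a • LinearMap.snd F F F + b • LinearMap.fst F F F + b • LinearMap.snd F F F)
    have hTv : ∀ x, T x = (a * x.1 - α * b * x.2, a * x.2 + b * x.1 + b * x.2) := fun _ => rfl
    have hT : Function.Injective T := by
      rw [← LinearMap.ker_eq_bot, LinearMap.ker_eq_bot']
      rintro ⟨x, y⟩ hxy
      rw [hTv, Prod.mk_eq_zero] at hxy
      obtain ⟨h1, h2⟩ := hxy
      have hx : (c : F) * x = 0 := by
        rw [← h]; linear_combination (a + b) * h1 + α * b * h2
      have hy : (c : F) * y = 0 := by
        rw [← h]; linear_combination a * h2 - b * h1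
      rw [Prod.mk_eq_zero]
      exact ⟨(mul_eq_zero.mp hx).resolve_left c.ne_zero,
        (mul_eq_zero.mp hy).resolve_left c.ne_zero⟩
    refine Isometric.wittClass_eq (φ := scale c (binary α hα)) (ψ := binary α hα)
      ⟨{ toLinearEquiv := LinearEquiv.ofInjectiveEndo T hT
         map_app' := ?_ }⟩
    rintro ⟨x, y⟩
    change (binary α hα).form (T (x, y)) = (c : F) * (binary α hα).form (x, y)
    rw [hTv, binary_form, binary_form, ← h]
    ring

/-- The chain relation `⟨x, y⟩ ⊗ φ = ⟨x + y, xy(x + y)⟩ ⊗ φ`. -/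
theorem scaleHom_add_scaleHom (x y c : Fˣ) (hc : (x : F) + y = c) (w : WittGroup F) :
    scaleHom x w + scaleHom y w = scaleHom c w + scaleHom (x * y * c) w := by
  obtain ⟨φ⟩ := w
  symm
  let T : φ.carrier × φ.carrier →ₗ[F] φ.carrier × φ.carrier :=
    LinearMap.prod (LinearMap.fst F _ _ + (y : F) • LinearMap.snd F _ _)
      (LinearMap.fst F _ _ - (x : F) • LinearMap.snd F _ _)
  have hTv : ∀ p, T p = (p.1 + (y : F) • p.2, p.1 - (x : F) • p.2) := fun _ => rfl
  have hT : Function.Injective T := by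
    rw [← LinearMap.ker_eq_bot, LinearMap.ker_eq_bot']
    rintro ⟨a, b⟩ hab
    rw [hTv, Prod.mk_eq_zero] at hab
    obtain ⟨h1, h2⟩ := hab
    have hb : (c : F) • b = 0 := by
      rw [← hc, add_smul]
      calc (x : F) • b + (y : F) • b = (a + (y : F) • b) - (a - (x : F) • b) := by abel
        _ = 0 := by rw [h1, h2, sub_zero]
    have hb0 : b = 0 := (smul_eq_zero.mp hb).resolve_left c.ne_zero
    subst hb0
    rw [smul_zero, add_zero] at h1
    exact Prod.ext h1 rfl
  refine Isometric.wittClass_eq (φ := orthSum (scale c φ) (scale (x * y * c) φ))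
    (ψ := orthSum (scale x φ) (scale y φ))
    ⟨{ toLinearEquiv := LinearEquiv.ofInjectiveEndo T hT, map_app' := ?_ }⟩
  rintro ⟨(a : φ.carrier), (b : φ.carrier)⟩
  change (x : F) * φ.form (a + (y : F) • b) + (y : F) * φ.form (a - (x : F) • b) =
    (c : F) * φ.form a + ((x * y * c : Fˣ) : F) * φ.form b
  rw [sub_eq_add_neg, ← neg_smul, QuadraticMap.map_add φ.form, QuadraticMap.map_add φ.form a,
    QuadraticMap.map_smul, QuadraticMap.map_smul, QuadraticMap.polar_smul_right,
    QuadraticMap.polar_smul_right, Units.val_mul, Units.val_mul, ← hc]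
  simp only [smul_eq_mul]
  ring

theorem IsRound.orthSum_scale {φ : EvenForm F} (h : IsRound φ) (β : Fˣ) :
    IsRound (orthSum φ (scale β φ)) := by
  have hcl : (orthSum φ (scale β φ)).wittClass = φ.wittClass + scaleHom β φ.wittClass := rfl
  refine ⟨?_, ?_⟩
  · rintro ⟨(u : φ.carrier), (v : φ.carrier)⟩ huv h0
    change φ.form u + (β : F) * φ.form v = 0 at h0
    rw [hcl]
    by_cases hφ : φ.wittClass = 0
    · rw [hφ, map_zero, add_zero]
    have hanis : ∀ x, φ.form x = 0 → x = 0 := fun x hx => by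
      by_contra hne
      exact hφ (h.1 x hne hx)
    have hv : φ.form v ≠ 0 := by
      intro hv
      rw [hv, mul_zero, add_zero] at h0
      exact huv (Prod.ext (hanis u h0) (hanis v hv))
    have hu : φ.form u ≠ 0 := by
      intro hu
      rw [hu, zero_add] at h0
      exact hv ((mul_eq_zero.mp h0).resolve_left β.ne_zero)
    have e1 := h.2 (Units.mk0 _ hu) u rfl
    have e2 := h.2 (Units.mk0 _ hv) v rfl
    have e3 : Units.mk0 _ hu = -1 * (β * Units.mk0 _ hv) := by
      ext
      push_cast
      rw [Units.val_mk0, Units.val_mk0]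
      linear_combination h0
    rw [e3, ← scaleHom_scaleHom, ← scaleHom_scaleHom, e2, scaleHom_neg_one] at e1
    nth_rw 1 [← e1]
    exact neg_add_cancel _
  · rintro c ⟨(u : φ.carrier), (v : φ.carrier)⟩ h0
    change φ.form u + (β : F) * φ.form v = c at h0
    rw [hcl, map_add]
    by_cases hv : φ.form v = 0
    · rw [hv, mul_zero, add_zero] at h0
      rw [scaleHom_scaleHom, mul_comm, ← scaleHom_scaleHom, h.2 c u h0]
    have e2 := h.2 (Units.mk0 _ hv) v rfl
    by_cases hu : φ.form u = 0
    · rw [hu, zero_add] at h0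
      have hc : c = β * Units.mk0 _ hv := by
        ext
        push_cast
        exact h0.symm
      rw [scaleHom_scaleHom, hc, ← scaleHom_scaleHom, e2, mul_right_comm, ← scaleHom_scaleHom, e2,
        scaleHom_mul_self, add_comm]
    have e1 := h.2 (Units.mk0 _ hu) u rfl
    have e3 := scaleHom_add_scaleHom (Units.mk0 _ hu) (β * Units.mk0 _ hv) c h0 φ.wittClass
    rw [e1, ← scaleHom_scaleHom β, e2] at e3
    rw [e3, mul_comm _ c, ← scaleHom_scaleHom c, mul_left_comm, ← scaleHom_scaleHom β,
      ← scaleHom_scaleHom, e2, e1]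

theorem IsRound.pfisterMul {φ : EvenForm F} (h : IsRound φ) (l : List Fˣ) :
    IsRound (pfisterMul l φ) := by
  induction l with
  | nil => exact h
  | cons β l ih => exact ih.orthSum_scale β

theorem IsRound.of_isometric {φ ψ : EvenForm F} (h : IsRound φ) (e : Isometric φ ψ) :
    IsRound ψ := by
  have hcl := e.wittClass_eq
  obtain ⟨e⟩ := e
  refine ⟨fun x hx h0 => hcl ▸ h.1 (e.symm x) ?_ ?_, fun c x hc => hcl ▸ h.2 c (e.symm x) ?_⟩
  · intro h1
    exact hx (e.toLinearEquiv.symm.map_eq_zero_iff.mp h1)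
  · rw [e.symm.map_app, h0]
  · rw [e.symm.map_app, hc]

theorem IsPfister.isRound {n : ℕ} {φ : EvenForm F} (h : IsPfister n φ) : IsRound φ := by
  obtain ⟨l, α, hα, -, e⟩ := h
  exact ((isRound_binary α hα).pfisterMul l).of_isometric e.symm

theorem exists_pfisterMul_eq_one {φ : EvenForm F} (h : ∃ x, φ.form x = 1) (l : List Fˣ) :
    ∃ x, (pfisterMul l φ).form x = 1 := by
  induction l with
  | nil => exact h
  | cons β l ih =>
    obtain ⟨x, hx⟩ := ih
    refine ⟨(x, (0 : (pfisterMul l φ).carrier)), ?_⟩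
    change (pfisterMul l φ).form x + (β : F) * (pfisterMul l φ).form 0 = 1
    rw [hx, QuadraticMap.map_zero, mul_zero, add_zero]

theorem IsPfister.exists_eq_one {n : ℕ} {φ : EvenForm F} (h : IsPfister n φ) :
    ∃ x, φ.form x = 1 := by
  obtain ⟨l, α, hα, -, ⟨e⟩⟩ := h
  obtain ⟨x, hx⟩ := exists_pfisterMul_eq_one (φ := binary α hα)
    ⟨((1, 0) : F × F), by rw [binary_form]; simp⟩ l
  exact ⟨e.symm x, by rw [e.symm.map_app, hx]⟩

theorem finrank_pfisterMul (l : List Fˣ) (φ : EvenForm F) :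
    Module.finrank F (pfisterMul l φ).carrier = 2 ^ l.length * Module.finrank F φ.carrier := by
  induction l with
  | nil => exact (one_mul _).symm
  | cons β l ih =>
    rw [pfisterMul, finrank_orthSum, finrank_scale, ih, List.length_cons]
    ring

theorem Isometric.finrank_eq {φ ψ : EvenForm F} (h : Isometric φ ψ) :
    Module.finrank F φ.carrier = Module.finrank F ψ.carrier := by
  obtain ⟨e⟩ := h
  exact e.toLinearEquiv.finrank_eq

theorem IsPfister.finrank_eq {n : ℕ} {φ : EvenForm F} (h : IsPfister n φ) :
    Module.finrank F φ.carrier = 2 ^ n := by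
  obtain ⟨l, α, hα, rfl, e⟩ := h
  rw [e.finrank_eq, finrank_pfisterMul, finrank_binary, pow_succ]

end EvenForm

/-! ### Quadratic forms given by matrices -/

section Matrix

variable {R S ι : Type*} [CommRing R] [CommRing S] [Fintype ι]

/-- The value at `x` of the quadratic form `∑ᵢⱼ Aᵢⱼ xᵢ xⱼ`. The matrix `A` need not be symmetric,
so that every quadratic form has this shape in every characteristic. -/
def quadEval (A : Matrix ι ι R) (x : ι → R) : R := x ⬝ᵥ A.mulVec x

/-- The polar form of `quadEval A`. -/
def polarEval (A : Matrix ι ι R) (x y : ι → R) : R := x ⬝ᵥ A.mulVec y + y ⬝ᵥ A.mulVec x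

variable (A : Matrix ι ι R)

theorem quadEval_add (x y : ι → R) :
    quadEval A (x + y) = quadEval A x + quadEval A y + polarEval A x y := by
  simp only [quadEval, polarEval, Matrix.mulVec_add, dotProduct_add, add_dotProduct]
  ring

theorem quadEval_smul (c : R) (x : ι → R) : quadEval A (c • x) = c * c * quadEval A x := by
  simp only [quadEval, Matrix.mulVec_smul, dotProduct_smul, smul_dotProduct, smul_eq_mul]
  ring

theorem quadEval_zero : quadEval A 0 = 0 := by
  simp [quadEval]

theorem polarEval_comm (x y : ι → R) : polarEval A x y = polarEval A y x :=
  add_comm _ _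

theorem polarEval_self (x : ι → R) : polarEval A x x = 2 * quadEval A x := by
  simp only [quadEval, polarEval]; ring

theorem polarEval_add_left (x x' y : ι → R) :
    polarEval A (x + x') y = polarEval A x y + polarEval A x' y := by
  simp only [polarEval, Matrix.mulVec_add, dotProduct_add, add_dotProduct]
  ring

theorem polarEval_smul_left (c : R) (x y : ι → R) :
    polarEval A (c • x) y = c * polarEval A x y := by
  simp only [polarEval, Matrix.mulVec_smul, dotProduct_smul, smul_dotProduct, smul_eq_mul]
  ring

theorem polarEval_smul_right (c : R) (x y : ι → R) :
    polarEval A x (c • y) = c * polarEval A x y := by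
  rw [polarEval_comm, polarEval_smul_left, polarEval_comm]

theorem polarEval_sub_left (x x' y : ι → R) :
    polarEval A (x - x') y = polarEval A x y - polarEval A x' y := by
  rw [sub_eq_add_neg, ← neg_one_smul R x', polarEval_add_left, polarEval_smul_left]
  ring

theorem quadEval_sub (x y : ι → R) :
    quadEval A (x - y) = quadEval A x + quadEval A y - polarEval A x y := by
  rw [sub_eq_add_neg, ← neg_one_smul R y, quadEval_add, quadEval_smul, polarEval_smul_right]
  ring

theorem polarEval_eq_dotProduct (x y : ι → R) :
    polarEval A x y = x ⬝ᵥ (A + A.transpose).mulVec y := by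
  rw [polarEval, Matrix.add_mulVec, dotProduct_add, Matrix.mulVec_transpose,
    dotProduct_comm x (Matrix.vecMul y A), Matrix.dotProduct_mulVec y]

theorem quadEval_smul_matrix (a : R) (x : ι → R) : quadEval (a • A) x = a * quadEval A x := by
  rw [quadEval, Matrix.smul_mulVec, dotProduct_smul]; rfl

theorem polarEval_smul_matrix (a : R) (x y : ι → R) :
    polarEval (a • A) x y = a * polarEval A x y := by
  simp only [polarEval, Matrix.smul_mulVec, dotProduct_smul, smul_eq_mul, mul_add]

theorem quadEval_map (g : R →+* S) (x : ι → R) :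
    quadEval (A.map g) (g ∘ x) = g (quadEval A x) := by
  rw [quadEval, quadEval, RingHom.map_dotProduct]
  congr 1
  ext i
  exact (RingHom.map_mulVec g A x i).symm

theorem polarEval_map (g : R →+* S) (x y : ι → R) :
    polarEval (A.map g) (g ∘ x) (g ∘ y) = g (polarEval A x y) := by
  have h := quadEval_add (A.map g) (g ∘ x) (g ∘ y)
  have h2 : g ∘ x + g ∘ y = g ∘ (x + y) := by ext i; simp
  rw [h2, quadEval_map, quadEval_map, quadEval_map, quadEval_add, map_add, map_add] at h
  exact (add_left_cancel h).symm

end Matrix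

theorem polarEval_nondegenerate_iff {K ι : Type*} [Field K] [Fintype ι] [DecidableEq ι]
    (A : Matrix ι ι K) :
    (∀ x, (∀ y, polarEval A x y = 0) → x = 0) ↔ (A + A.transpose).det ≠ 0 := by
  rw [← not_iff_not, not_not, ← Matrix.exists_vecMul_eq_zero_iff]
  push Not
  refine exists_congr fun x => ?_
  rw [and_comm]
  refine and_congr_right fun _ => ?_
  simp_rw [polarEval_eq_dotProduct, Matrix.dotProduct_mulVec]
  exact ⟨fun h => dotProduct_eq_zero_iff.mp h, fun h y => by rw [h, zero_dotProduct]⟩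

theorem polarEval_nondegenerate_map {K L ι : Type*} [Field K] [Field L] [Fintype ι]
    (f : K →+* L) {A : Matrix ι ι K} (h : ∀ x, (∀ y, polarEval A x y = 0) → x = 0) :
    ∀ x, (∀ y, polarEval (A.map f) x y = 0) → x = 0 := by
  classical
  rw [polarEval_nondegenerate_iff] at h ⊢
  have h1 : (A.map f + (A.map f).transpose) = f.mapMatrix (A + A.transpose) := by
    ext i j; simp
  rw [h1, ← RingHom.map_det]
  exact (map_ne_zero f).mpr h

namespace EvenForm

variable {F E : Type u} [Field F] [Field E]

/-- The form on `Fⁿ` with a given matrix. -/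
noncomputable def ofMatrix {n : ℕ} (A : Matrix (Fin n) (Fin n) F)
    (hA : ∀ x, (∀ y, polarEval A x y = 0) → x = 0) (hn : Even n) : EvenForm F where
  carrier := Fin n → F
  form := Matrix.toQuadraticForm' A
  nonsingular := by
    have h1 : ∀ x, A.toQuadraticForm' x = quadEval A x := fun x =>
      Matrix.toLinearMap₂'_apply' A x x
    intro x h
    refine hA x fun y => ?_
    rw [← h y, QuadraticMap.polar, h1, h1, h1, quadEval_add]
    ring
  even_dim := by rwa [Module.finrank_fin_fun]

theorem ofMatrix_form {n : ℕ} (A : Matrix (Fin n) (Fin n) F)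
    (hA : ∀ x, (∀ y, polarEval A x y = 0) → x = 0) (hn : Even n) (x : Fin n → F) :
    (ofMatrix A hA hn).form x = quadEval A x :=
  Matrix.toLinearMap₂'_apply' A x x

theorem exists_matrix (φ : EvenForm F) :
    ∃ (A : Matrix (Fin (Module.finrank F φ.carrier)) (Fin (Module.finrank F φ.carrier)) F)
      (e : (Fin (Module.finrank F φ.carrier) → F) ≃ₗ[F] φ.carrier),
      ∀ x, φ.form (e x) = quadEval A x := by
  obtain ⟨B, hB⟩ := LinearMap.BilinMap.toQuadraticMap_surjective (R := F) (M := φ.carrier)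
    (N := F) φ.form
  let e := (Module.finBasis F φ.carrier).equivFun.symm
  refine ⟨LinearMap.toMatrix₂' F (B.compl₁₂ e.toLinearMap e.toLinearMap), e, fun x => ?_⟩
  rw [quadEval, ← Matrix.toLinearMap₂'_apply', Matrix.toLinearMap₂'_toMatrix', ← hB]
  rfl

/-- A matrix of the form `φ`, with respect to some basis. -/
noncomputable def gram (φ : EvenForm F) :
    Matrix (Fin (Module.finrank F φ.carrier)) (Fin (Module.finrank F φ.carrier)) F :=
  φ.exists_matrix.choose

/-- The coordinates belonging to `gram φ`. -/
noncomputable def coord (φ : EvenForm F) :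
    (Fin (Module.finrank F φ.carrier) → F) ≃ₗ[F] φ.carrier :=
  φ.exists_matrix.choose_spec.choose

theorem form_coord (φ : EvenForm F) (x) : φ.form (φ.coord x) = quadEval φ.gram x :=
  φ.exists_matrix.choose_spec.choose_spec x

theorem gram_nondegenerate (φ : EvenForm F) :
    ∀ x, (∀ y, polarEval φ.gram x y = 0) → x = 0 := by
  intro x h
  rw [← φ.coord.map_eq_zero_iff]
  refine φ.nonsingular _ fun y => ?_
  obtain ⟨y, rfl⟩ := φ.coord.surjective y
  rw [← h y, QuadraticMap.polar, ← map_add, form_coord, form_coord, form_coord, quadEval_add]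
  ring

/-! ### Extension of scalars -/

/-- `ψ` is the form over `E` obtained from `φ` by extension of scalars along `f : F → E`: there is
a semilinear map that is compatible with the forms and identifies the space of `ψ` with
the tensor product of `E` and the space of `φ`. -/
def IsScalarExt (f : F →+* E) (φ : EvenForm F) (ψ : EvenForm E) : Prop :=
  ∃ j : φ.carrier →ₛₗ[f] ψ.carrier, (∀ v, ψ.form (j v) = f (φ.form v)) ∧
    Submodule.span E (Set.range j) = ⊤ ∧
    Module.finrank E ψ.carrier = Module.finrank F φ.carrier

/-- Extension of scalars of a form along `f : F → E`, in coordinates. -/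
noncomputable def scalarExt (f : F →+* E) (φ : EvenForm F) : EvenForm E :=
  ofMatrix (φ.gram.map f) (polarEval_nondegenerate_map f φ.gram_nondegenerate) φ.even_dim

theorem isScalarExt_scalarExt (f : F →+* E) (φ : EvenForm F) :
    IsScalarExt f φ (scalarExt f φ) := by
  let j : φ.carrier →ₛₗ[f] (Fin (Module.finrank F φ.carrier) → E) :=
    { toFun := fun v => f ∘ φ.coord.symm v
      map_add' := fun v w => by ext i; simp
      map_smul' := fun c v => by ext i; simp }
  have hspan : Submodule.span E (Set.range j) = ⊤ := by
    rw [Submodule.eq_top_iff']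
    intro x
    rw [pi_eq_sum_univ' x]
    refine Submodule.sum_mem _ fun i _ => Submodule.smul_mem _ _ (Submodule.subset_span ?_)
    refine ⟨φ.coord (Pi.single i 1), ?_⟩
    ext k
    change f (φ.coord.symm (φ.coord (Pi.single i 1)) k) = _
    rw [LinearEquiv.symm_apply_apply, Pi.single_apply, Pi.single_apply, apply_ite f, map_one,
      map_zero]
  refine ⟨j, fun v => ?_, hspan, (Module.finrank_fin_fun E : Module.finrank E (Fin _ → E) = _)⟩
  refine (ofMatrix_form _ _ _ _).trans ((quadEval_map _ f _).trans ?_)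
  rw [← form_coord, LinearEquiv.apply_symm_apply]

variable {f : F →+* E}

theorem IsScalarExt.of_isometric {φ φ' : EvenForm F} {ψ : EvenForm E} (h : IsScalarExt f φ ψ)
    (e : Isometric φ φ') : IsScalarExt f φ' ψ := by
  obtain ⟨j, h1, h2, h3⟩ := h
  have hd := e.finrank_eq
  obtain ⟨e⟩ := e
  refine ⟨j.comp e.symm.toLinearEquiv.toLinearMap, fun v => ?_, ?_, h3.trans hd⟩
  · rw [← e.symm.map_app v]
    exact h1 _
  · rw [← h2]
    congr 1
    exact e.symm.toLinearEquiv.surjective.range_comp j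

/-- Extension of scalars is unique up to isometry. -/
theorem IsScalarExt.isometric {φ : EvenForm F} {ψ ψ' : EvenForm E} (h : IsScalarExt f φ ψ)
    (h' : IsScalarExt f φ ψ') : Isometric ψ ψ' := by
  obtain ⟨j, h1, h2, h3⟩ := h
  obtain ⟨j', h1', h2', h3'⟩ := h'
  let b := Module.finBasis F φ.carrier
  have hspan : ∀ {χ : EvenForm E} (k : φ.carrier →ₛₗ[f] χ.carrier),
      Submodule.span E (Set.range k) = ⊤ → ⊤ ≤ Submodule.span E (Set.range (k ∘ b)) := by
    intro χ k hk
    rw [← hk, Submodule.span_le]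
    rintro _ ⟨v, rfl⟩
    rw [← b.sum_repr v, map_sum]
    refine Submodule.sum_mem _ fun i _ => ?_
    rw [map_smulₛₗ]
    exact Submodule.smul_mem _ _ (Submodule.subset_span ⟨i, rfl⟩)
  let c := basisOfTopLeSpanOfCardEqFinrank (j ∘ b) (hspan j h2) (by rw [Fintype.card_fin, h3])
  let c' := basisOfTopLeSpanOfCardEqFinrank (j' ∘ b) (hspan j' h2') (by rw [Fintype.card_fin, h3'])
  let T := c.equiv c' (Equiv.refl _)
  have hT : ∀ v, T (j v) = j' v := by
    intro v
    have hb : ∀ i, T (j (b i)) = j' (b i) := by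
      intro i
      have hc : c i = j (b i) := by
        rw [coe_basisOfTopLeSpanOfCardEqFinrank]; rfl
      have hc' : c' i = j' (b i) := by
        rw [coe_basisOfTopLeSpanOfCardEqFinrank]; rfl
      rw [← hc, ← hc']
      exact c.equiv_apply i c' _
    rw [← b.sum_repr v, map_sum, map_sum, map_sum]
    refine Finset.sum_congr rfl fun i _ => ?_
    rw [map_smulₛₗ, map_smulₛₗ j', map_smul, hb]
  let Q : QuadraticForm E ψ.carrier := ψ'.form.comp T.toLinearMap
  have hQ : ∀ v, Q (j v) = ψ.form (j v) := by
    intro v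
    change ψ'.form (T (j v)) = _
    rw [hT, h1, h1']
  have hpol : Q.polarBilin = ψ.form.polarBilin := by
    refine LinearMap.ext_on h2 ?_
    rintro _ ⟨v, rfl⟩
    refine LinearMap.ext_on h2 ?_
    rintro _ ⟨w, rfl⟩
    change QuadraticMap.polar Q (j v) (j w) = QuadraticMap.polar ψ.form (j v) (j w)
    rw [QuadraticMap.polar, QuadraticMap.polar, ← map_add, hQ, hQ, hQ]
  have hval : ∀ x, Q x = ψ.form x := by
    intro x
    have hx : x ∈ Submodule.span E (Set.range j) := h2 ▸ Submodule.mem_top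
    induction hx using Submodule.span_induction with
    | mem x hx => obtain ⟨v, rfl⟩ := hx; exact hQ v
    | zero => rw [QuadraticMap.map_zero, QuadraticMap.map_zero]
    | add x y _ _ hx hy =>
      have h4 : QuadraticMap.polar Q x y = QuadraticMap.polar ψ.form x y :=
        LinearMap.congr_fun (LinearMap.congr_fun hpol x) y
      rw [QuadraticMap.map_add Q, QuadraticMap.map_add ψ.form, hx, hy, h4]
    | smul c x _ hx => rw [QuadraticMap.map_smul, QuadraticMap.map_smul, hx]
  exact ⟨{ toLinearEquiv := T, map_app' := hval }⟩

theorem IsScalarExt.orthSum {φ φ' : EvenForm F} {ψ ψ' : EvenForm E} (h : IsScalarExt f φ ψ)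
    (h' : IsScalarExt f φ' ψ') : IsScalarExt f (orthSum φ φ') (orthSum ψ ψ') := by
  obtain ⟨j, h1, h2, h3⟩ := h
  obtain ⟨j', h1', h2', h3'⟩ := h'
  let k : φ.carrier × φ'.carrier →ₛₗ[f] ψ.carrier × ψ'.carrier :=
    { toFun := fun p => (j p.1, j' p.2)
      map_add' := fun p q => by simp
      map_smul' := fun c p => by simp }
  refine ⟨k, fun p => ?_, ?_, ?_⟩
  · change ψ.form (j p.1) + ψ'.form (j' p.2) = f (φ.form p.1 + φ'.form p.2)
    rw [h1, h1', map_add]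
  · have e1 : Submodule.map (LinearMap.inl E ψ.carrier ψ'.carrier) ⊤ ≤
        Submodule.span E (Set.range k) := by
      rw [← h2, Submodule.map_span, Submodule.span_le]
      rintro _ ⟨_, ⟨v, rfl⟩, rfl⟩
      exact Submodule.subset_span ⟨(v, 0), by simp [k]⟩
    have e2 : Submodule.map (LinearMap.inr E ψ.carrier ψ'.carrier) ⊤ ≤
        Submodule.span E (Set.range k) := by
      rw [← h2', Submodule.map_span, Submodule.span_le]
      rintro _ ⟨_, ⟨v, rfl⟩, rfl⟩
      exact Submodule.subset_span ⟨(0, v), by simp [k]⟩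
    rw [eq_top_iff]
    rintro ⟨x, y⟩ -
    have e3 : ((x, y) : ψ.carrier × ψ'.carrier) =
        LinearMap.inl E _ _ x + LinearMap.inr E _ _ y := by simp
    change ((x, y) : ψ.carrier × ψ'.carrier) ∈ Submodule.span E (Set.range k)
    rw [e3]
    exact Submodule.add_mem _ (e1 ⟨x, trivial, rfl⟩) (e2 ⟨y, trivial, rfl⟩)
  · rw [finrank_orthSum, finrank_orthSum, h3, h3']

theorem IsScalarExt.scale {φ : EvenForm F} {ψ : EvenForm E} (h : IsScalarExt f φ ψ) (a : Fˣ) :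
    IsScalarExt f (scale a φ) (scale (Units.map f a) ψ) := by
  obtain ⟨j, h1, h2, h3⟩ := h
  refine ⟨j, fun (v : φ.carrier) => ?_, h2, h3⟩
  change f a * ψ.form (j v) = f ((a : F) * φ.form v)
  rw [h1, map_mul]

theorem IsScalarExt.pfisterMul {φ : EvenForm F} {ψ : EvenForm E} (h : IsScalarExt f φ ψ)
    (l : List Fˣ) :
    IsScalarExt f (pfisterMul l φ) (pfisterMul (l.map (Units.map (f : F →* E))) ψ) := by
  induction l with
  | nil => exact h
  | cons β l ih => exact ih.orthSum (ih.scale β)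

theorem isScalarExt_binary (f : F →+* E) (α : F) (hα : 4 * α ≠ 1) (hα' : 4 * f α ≠ 1) :
    IsScalarExt f (binary α hα) (binary (f α) hα') := by
  let j : F × F →ₛₗ[f] E × E :=
    { toFun := fun p => (f p.1, f p.2)
      map_add' := fun p q => by simp
      map_smul' := fun c p => by simp }
  refine ⟨j, fun (p : F × F) => ?_, ?_, ?_⟩
  · change f p.1 * f p.1 + f p.1 * f p.2 + f α * (f p.2 * f p.2) =
      f (p.1 * p.1 + p.1 * p.2 + α * (p.2 * p.2))
    simp only [map_add, map_mul]
  · rw [eq_top_iff]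
    rintro ⟨x, y⟩ -
    change ((x, y) : E × E) ∈ Submodule.span E (Set.range j)
    have e3 : ((x, y) : E × E) = x • j (1, 0) + y • j (0, 1) := by simp [j]
    rw [e3]
    exact Submodule.add_mem _ (Submodule.smul_mem _ _ (Submodule.subset_span ⟨_, rfl⟩))
      (Submodule.smul_mem _ _ (Submodule.subset_span ⟨_, rfl⟩))
  · rw [finrank_binary, finrank_binary]

theorem IsPfister.scalarExt {n : ℕ} {φ : EvenForm F} (h : IsPfister n φ) (f : F →+* E) :
    IsPfister n (scalarExt f φ) := by
  obtain ⟨l, α, hα, hl, e⟩ := h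
  have hα' : 4 * f α ≠ 1 := by
    intro h
    apply hα
    apply f.injective
    rw [map_mul, map_one, map_ofNat, h]
  refine ⟨l.map (Units.map (f : F →* E)), f α, hα', by rw [List.length_map, hl], ?_⟩
  exact ((isScalarExt_scalarExt f φ).of_isometric e).isometric
    ((isScalarExt_binary f α hα hα').pfisterMul l)

theorem IsScalarExt.exists_isLagrangian {φ : EvenForm F} {ψ : EvenForm E}
    (h : IsScalarExt f φ ψ) {W : Submodule F φ.carrier} (hW : φ.IsLagrangian W) :
    ∃ W', ψ.IsLagrangian W' := by
  obtain ⟨j, h1, h2, h3⟩ := h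
  have hle : ∀ U : Submodule F φ.carrier,
      Module.finrank E (Submodule.span E (j '' U)) ≤ Module.finrank F U := by
    intro U
    let b := Module.finBasis F U
    have h4 : Submodule.span E (j '' U) ≤
        Submodule.span E (Set.range fun i => j (b i : φ.carrier)) := by
      rw [Submodule.span_le]
      rintro _ ⟨v, hv, rfl⟩
      have h5 : v = ∑ i, (b.repr ⟨v, hv⟩ i) • (b i : φ.carrier) := by
        have h6 := congrArg U.subtype (b.sum_repr ⟨v, hv⟩)
        rw [map_sum] at h6
        exact h6.symm
      rw [h5, map_sum]
      refine Submodule.sum_mem _ fun i _ => ?_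
      rw [map_smulₛₗ]
      exact Submodule.smul_mem _ _ (Submodule.subset_span ⟨i, rfl⟩)
    refine (Submodule.finrank_mono h4).trans ((finrank_range_le_card _).trans ?_)
    rw [Fintype.card_fin]
  refine ⟨Submodule.span E (j '' W), fun x hx => ?_, ?_⟩
  · have hpol : ∀ v ∈ W, ∀ w ∈ W, ψ.form.polarBilin (j v) (j w) = 0 := by
      intro v hv w hw
      change QuadraticMap.polar ψ.form (j v) (j w) = 0
      rw [QuadraticMap.polar, ← map_add, h1, h1, h1, hW.1 _ hv, hW.1 _ hw,
        hW.1 _ (W.add_mem hv hw)]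
      simp
    have hpol' : ∀ x ∈ Submodule.span E (j '' W), ∀ y ∈ Submodule.span E (j '' W),
        ψ.form.polarBilin x y = 0 := by
      intro x hx y hy
      induction hx, hy using Submodule.span_induction₂ with
      | mem_mem x y hx hy =>
        obtain ⟨v, hv, rfl⟩ := hx
        obtain ⟨w, hw, rfl⟩ := hy
        exact hpol v hv w hw
      | zero_left => rw [map_zero]; rfl
      | zero_right => rw [map_zero]
      | add_left x y z _ _ _ h h' => rw [map_add, LinearMap.add_apply, h, h', add_zero]
      | add_right x y z _ _ _ h h' => rw [map_add, h, h', add_zero]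
      | smul_left r x y _ _ h => rw [map_smul, LinearMap.smul_apply, h, smul_zero]
      | smul_right r x y _ _ h => rw [map_smul, h, smul_zero]
    induction hx using Submodule.span_induction with
    | mem x hx =>
      obtain ⟨v, hv, rfl⟩ := hx
      rw [h1, hW.1 v hv, map_zero]
    | zero => exact QuadraticMap.map_zero _
    | add x y hx hy hx0 hy0 =>
      have h4 : QuadraticMap.polar ψ.form x y = 0 := hpol' x hx y hy
      rw [QuadraticMap.map_add ψ.form, hx0, hy0, h4, add_zero, add_zero]
    | smul c x _ hx0 => rw [QuadraticMap.map_smul, hx0, smul_zero]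
  · obtain ⟨M, hM⟩ := Submodule.exists_isCompl W
    have hdim := Submodule.finrank_add_eq_of_isCompl hM
    have hsup : Submodule.span E (j '' W) ⊔ Submodule.span E (j '' M) = ⊤ := by
      rw [eq_top_iff, ← h2, Submodule.span_le]
      rintro _ ⟨v, rfl⟩
      obtain ⟨a, ha, b, hb, rfl⟩ :=
        Submodule.mem_sup.mp (hM.sup_eq_top ▸ Submodule.mem_top : v ∈ W ⊔ M)
      rw [map_add]
      exact Submodule.add_mem_sup (Submodule.subset_span ⟨a, ha, rfl⟩)
        (Submodule.subset_span ⟨b, hb, rfl⟩)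
    have h4 := Submodule.finrank_sup_add_finrank_inf_eq (Submodule.span E (j '' W))
      (Submodule.span E (j '' M))
    rw [hsup, finrank_top] at h4
    have h5 := hle M
    have h6 := hW.2
    omega

theorem IsScalarExt.wittClass_eq_zero {φ : EvenForm F} {ψ : EvenForm E}
    (h : IsScalarExt f φ ψ) (h0 : φ.wittClass = 0) : ψ.wittClass = 0 := by
  obtain ⟨W, hW⟩ := wittClass_eq_zero_iff.mp h0
  exact wittClass_eq_zero_iff.mpr (h.exists_isLagrangian hW)

end EvenForm

namespace WittGroup

open EvenForm

variable {F E : Type u} [Field F] [Field E]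

/-- The homomorphism of Witt groups induced by extension of scalars. -/
noncomputable def scalarExtHom (f : F →+* E) : WittGroup F →+ WittGroup E where
  toFun := Quotient.lift (fun φ => (scalarExt f φ).wittClass) fun φ ψ h => by
    have h1 := ((isScalarExt_scalarExt f φ).orthSum
      ((isScalarExt_scalarExt f ψ).scale (-1))).wittClass_eq_zero
      (by rw [wittClass_orthSum, wittClass_scale_neg_one, wittEquiv_iff.mp h, add_neg_cancel])
    have h2 : Units.map (f : F →* E) (-1) = -1 := by ext; simp
    rw [h2, wittClass_orthSum, wittClass_scale_neg_one, add_neg_eq_zero] at h1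
    exact h1
  map_zero' := (isScalarExt_scalarExt f _).wittClass_eq_zero (wittClass_hyperbolic _)
  map_add' := by
    rintro ⟨φ⟩ ⟨ψ⟩
    exact ((isScalarExt_scalarExt f _).isometric ((isScalarExt_scalarExt f φ).orthSum
      (isScalarExt_scalarExt f ψ))).wittClass_eq

theorem scalarExtHom_wittClass (f : F →+* E) (φ : EvenForm F) :
    scalarExtHom f φ.wittClass = (scalarExt f φ).wittClass := rfl

theorem scalarExtHom_scaleHom (f : F →+* E) (a : Fˣ) (x : WittGroup F) :
    scalarExtHom f (scaleHom a x) = scaleHom (Units.map f a) (scalarExtHom f x) := by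
  obtain ⟨φ⟩ := x
  exact ((isScalarExt_scalarExt f _).isometric
    ((isScalarExt_scalarExt f φ).scale a)).wittClass_eq

end WittGroup

/-! ### Forms that become hyperbolic over a quadratic extension -/

/-- Let `θ` be a root of `X² + tX + n` and let `L = E ⊕ Eθ`. If the anisotropic form `A` over `E`
has a Lagrangian over `L`, then its set of values is closed under multiplication by `n`: the vectors
of the Lagrangian are `v + θ w` with `w` arbitrary and `v` determined by `w`, and the value
`A(v + θ w) = (A(v) - n A(w)) + θ (…)` is zero. -/
theorem exists_quadEval_eq_mul {E L : Type*} [Field E] [Field L] [Algebra E L]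
    (hfin : Module.finrank E L = 2) {θ : L} {t n : E}
    (hθ : θ * θ + algebraMap E L t * θ + algebraMap E L n = 0) (V W : L →ₗ[E] E)
    (hVW : ∀ z, z = algebraMap E L (V z) + algebraMap E L (W z) * θ)
    (hθi : ∀ a b, algebraMap E L a + algebraMap E L b * θ = 0 → a = 0)
    {m : ℕ} {A : Matrix (Fin m) (Fin m) E} (hA : ∀ x, quadEval A x = 0 → x = 0)
    (M : Submodule L (Fin m → L)) (hM : ∀ x ∈ M, quadEval (A.map (algebraMap E L)) x = 0)
    (hMd : m ≤ 2 * Module.finrank L M) (w : Fin m → E) :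
    ∃ v, quadEval A v = n * quadEval A w := by
  have : FiniteDimensional E L := FiniteDimensional.of_finrank_eq_succ hfin
  have : FiniteDimensional E M := FiniteDimensional.trans E L M
  have key : ∀ y ∈ M, quadEval A (V ∘ y) = n * quadEval A (W ∘ y) := by
    intro y hy
    have h1 := hM y hy
    have h2 : y = algebraMap E L ∘ (V ∘ y) + θ • (algebraMap E L ∘ (W ∘ y)) := by
      ext i
      rw [Pi.add_apply, Pi.smul_apply, smul_eq_mul, mul_comm]
      exact hVW (y i)
    rw [h2, quadEval_add, quadEval_smul, polarEval_smul_right, quadEval_map, quadEval_map,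
      polarEval_map] at h1
    refine sub_eq_zero.mp (hθi _ (polarEval A (V ∘ y) (W ∘ y) - t * quadEval A (W ∘ y)) ?_)
    simp only [map_sub, map_mul]
    linear_combination h1 - algebraMap E L (quadEval A (W ∘ y)) * hθ
  let S : M →ₗ[E] (Fin m → E) :=
    { toFun := fun y => W ∘ y.1
      map_add' := fun x y => by ext i; simp
      map_smul' := fun c x => by ext i; simp }
  have hS : Function.Injective S := by
    rw [← LinearMap.ker_eq_bot, LinearMap.ker_eq_bot']
    intro y hy
    have h0 : W ∘ y.1 = 0 := hy
    have h1 := key y y.2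
    rw [h0, quadEval_zero, mul_zero] at h1
    have h2 := hA _ h1
    ext i
    rw [hVW (y.1 i)]
    have h3 : V (y.1 i) = 0 := congrFun h2 i
    have h4 : W (y.1 i) = 0 := congrFun h0 i
    rw [h3, h4]
    simp
  have hdim : Module.finrank E M = Module.finrank E (Fin m → E) := by
    refine le_antisymm (LinearMap.finrank_le_finrank_of_injective hS) ?_
    rw [Module.finrank_fin_fun, ← Module.finrank_mul_finrank E L M, hfin]
    exact hMd
  obtain ⟨y, rfl⟩ := (LinearMap.injective_iff_surjective_of_finrank_eq_finrank hdim).mp hS w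
  exact ⟨V ∘ y.1, key y y.2⟩

open Polynomial in
theorem exists_quadEval_eq_mul_of_adjoinRoot {E : Type*} [Field E] {t n : E} {P : E[X]}
    (hP : P = X ^ 2 + C t * X + C n) [hirr : Fact (Irreducible P)]
    {m : ℕ} {A : Matrix (Fin m) (Fin m) E} (hA : ∀ x, quadEval A x = 0 → x = 0)
    (M : Submodule (AdjoinRoot P) (Fin m → AdjoinRoot P))
    (hM : ∀ x ∈ M, quadEval (A.map (AdjoinRoot.of P)) x = 0)
    (hMd : m ≤ 2 * Module.finrank (AdjoinRoot P) M) (w : Fin m → E) :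
    ∃ v, quadEval A v = n * quadEval A w := by
  have hmon : P.Monic := by
    rw [hP]; monicity!
  have hdeg : P.natDegree = 2 := by
    rw [hP]; compute_degree!
  have hdeg' : P.degree = 2 := by rw [degree_eq_natDegree hmon.ne_zero, hdeg]; rfl
  have hP2 : ∀ z, (AdjoinRoot.modByMonicHom hmon z).degree < 2 := by
    intro z
    obtain ⟨q, rfl⟩ := AdjoinRoot.mk_surjective z
    rw [AdjoinRoot.modByMonicHom_mk, ← hdeg']
    exact degree_modByMonic_lt _ hmon
  refine exists_quadEval_eq_mul (E := E) (L := AdjoinRoot P) (θ := AdjoinRoot.root P) (t := t) ?_ ?_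
    ((lcoeff E 0) ∘ₗ AdjoinRoot.modByMonicHom hmon) ((lcoeff E 1) ∘ₗ AdjoinRoot.modByMonicHom hmon)
    (fun z => ?_) (fun a b h => ?_) hA M hM hMd w
  · rw [(AdjoinRoot.powerBasis hirr.out.ne_zero).finrank, AdjoinRoot.powerBasis_dim, hdeg]
  · have h := AdjoinRoot.eval₂_root P
    have h2 : P.eval₂ (AdjoinRoot.of P) (AdjoinRoot.root P) =
        (X ^ 2 + C t * X + C n).eval₂ (AdjoinRoot.of P) (AdjoinRoot.root P) :=
      congrArg _ hP
    rw [h2] at h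
    simp only [eval₂_add, eval₂_mul, eval₂_pow, eval₂_X, eval₂_C] at h
    rw [← h, AdjoinRoot.algebraMap_eq]
    ring
  · have h1 := hP2 z
    have h2 := eq_X_add_C_of_degree_le_one (p := AdjoinRoot.modByMonicHom hmon z)
      (degree_le_iff_coeff_zero _ _ |>.mpr fun k hk => coeff_eq_zero_of_degree_lt
      (h1.trans_le (by exact_mod_cast Nat.succ_le_of_lt (by exact_mod_cast hk))))
    have h3 := AdjoinRoot.mk_leftInverse hmon z
    rw [h2] at h3
    conv_lhs => rw [← h3]
    simp only [map_add, map_mul, AdjoinRoot.mk_C, AdjoinRoot.mk_X, LinearMap.comp_apply,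
      lcoeff_apply, AdjoinRoot.algebraMap_eq]
    ring
  · have h1 : AdjoinRoot.mk P (C b * X + C a) = 0 := by
      rw [← h]
      simp only [map_add, map_mul, AdjoinRoot.mk_C, AdjoinRoot.mk_X, AdjoinRoot.algebraMap_eq]
      ring
    rw [AdjoinRoot.mk_eq_zero] at h1
    have h2 : C b * X + C a = 0 := by
      refine eq_zero_of_dvd_of_degree_lt h1 ?_
      rw [hdeg']
      exact lt_of_le_of_lt degree_linear_le (by norm_num)
    simpa using congrArg (fun p => coeff p 0) h2

/-! ### Anisotropic forms over polynomial rings -/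

section

open Polynomial



section

variable {E ι : Type*} [Field E] [Fintype ι] {A : Matrix ι ι E}

theorem natDegree_mulVec_le (A : Matrix ι ι E) {g : ι → E[X]} {d : ℕ}
    (hg : ∀ i, (g i).natDegree ≤ d) (i : ι) : ((A.map C).mulVec g i).natDegree ≤ d := by
  refine natDegree_sum_le_of_forall_le _ _ fun j _ => ?_
  exact (natDegree_C_mul_le _ _).trans (hg j)

theorem natDegree_quadEval_le (A : Matrix ι ι E) {g : ι → E[X]} {d : ℕ}
    (hg : ∀ i, (g i).natDegree ≤ d) : (quadEval (A.map C) g).natDegree ≤ d + d :=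
  natDegree_sum_le_of_forall_le _ _ fun i _ =>
    natDegree_mul_le_of_le (hg i) (natDegree_mulVec_le A hg i)

theorem coeff_quadEval (A : Matrix ι ι E) {g : ι → E[X]} {d : ℕ}
    (hg : ∀ i, (g i).natDegree ≤ d) :
    (quadEval (A.map C) g).coeff (d + d) = quadEval A fun i => (g i).coeff d := by
  simp only [quadEval, dotProduct, finsetSum_coeff]
  refine Finset.sum_congr rfl fun i _ => ?_
  rw [coeff_mul_add_eq_of_natDegree_le (hg i) (natDegree_mulVec_le A hg i)]
  congr 1
  simp only [Matrix.mulVec, dotProduct, finsetSum_coeff, Matrix.map_apply, coeff_C_mul]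

/-- For an anisotropic form over the constants, the degree of the value is twice the degree of the
vector: the leading coefficients cannot cancel. -/
theorem natDegree_le_of_natDegree_quadEval_le (hA : ∀ x, quadEval A x = 0 → x = 0)
    {g : ι → E[X]} {d : ℕ} (h : (quadEval (A.map C) g).natDegree ≤ d + d) (i : ι) :
    (g i).natDegree ≤ d := by
  by_contra! hi
  obtain ⟨k, -, hk⟩ := Finset.exists_max_image Finset.univ (fun i => (g i).natDegree) ⟨i, by simp⟩
  have hk' : ∀ j, (g j).natDegree ≤ (g k).natDegree := fun j => hk j (Finset.mem_univ j)
  have hlt := hi.trans_le (hk' i)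
  have h1 := coeff_quadEval A hk'
  rw [coeff_eq_zero_of_natDegree_lt (by omega)] at h1
  have h2 := congrFun (hA _ h1.symm) k
  have h3 : g k = 0 := leadingCoeff_eq_zero.mp h2
  rw [h3] at hlt
  simp at hlt

theorem quadEval_map_C (A : Matrix ι ι E) (x : ι → E) :
    quadEval (A.map C) (fun i => C (x i)) = C (quadEval A x) :=
  quadEval_map A C x

theorem eq_zero_of_quadEval_map_C_eq_zero (hA : ∀ x, quadEval A x = 0 → x = 0) (g : ι → E[X])
    (h : quadEval (A.map C) g = 0) : g = 0 := by
  have h1 : ∀ i, g i = C ((g i).coeff 0) := fun i => eq_C_of_natDegree_le_zero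
    (natDegree_le_of_natDegree_quadEval_le hA (d := 0) (by rw [h]; simp) i)
  have h2 : g = fun i => C ((g i).coeff 0) := funext h1
  rw [h2, quadEval_map_C, C_eq_zero] at h
  have h3 := hA _ h
  ext1 i
  rw [h1 i, show (g i).coeff 0 = 0 from congrFun h3 i, C_0]
  rfl

/-- The Cassels–Pfister theorem for an anisotropic form over a field `E`: a polynomial represented
over `E(X)` by `g / h` is represented over `E[X]`. The representing vector can be chosen with the
same value at each linear form over `E` that is a polynomial at `g / h`. If `s` is the polynomial
part of `g / h`, then the second point on the line through `g / h` and `s` that represents `p` has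
a denominator of smaller degree. -/
theorem exists_polynomial_quadEval_eq (hA : ∀ x, quadEval A x = 0 → x = 0) (p : E[X])
    (h : E[X]) (hh : h ≠ 0) (g : ι → E[X]) (hg : quadEval (A.map C) g = p * (h * h)) :
    ∃ g' : ι → E[X], quadEval (A.map C) g' = p ∧
      ∀ (l : ι → E) (q : E[X]), (fun i => C (l i)) ⬝ᵥ g = h * q →
        (fun i => C (l i)) ⬝ᵥ g' = q := by
  induction hn : h.natDegree using Nat.strong_induction_on generalizing h g with
  | _ d ih =>
  subst hn
  by_cases hd : h.natDegree = 0
  · obtain ⟨u, rfl⟩ : ∃ u, h = C u := ⟨_, eq_C_of_natDegree_eq_zero hd⟩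
    have hu : u ≠ 0 := by rintro rfl; simp at hh
    have hinv : C u⁻¹ * C u = (1 : E[X]) := by rw [← C_mul, inv_mul_cancel₀ hu, C_1]
    refine ⟨C u⁻¹ • g, ?_, fun l q hl => ?_⟩
    · rw [quadEval_smul, hg]
      linear_combination (p * (C u⁻¹ * C u) + p) * hinv
    · rw [dotProduct_smul, hl, smul_eq_mul]
      linear_combination q * hinv
  set s : ι → E[X] := fun i => g i / h with hs
  set r : ι → E[X] := fun i => g i % h with hr
  have hgsr : g = h • s + r := by
    ext1 i
    exact (EuclideanDomain.div_add_mod (g i) h).symm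
  have hrdeg : ∀ i, (r i).natDegree < h.natDegree := fun i => natDegree_mod_lt (g i) hd
  -- a linear form that is a polynomial at `g / h` vanishes at the remainder
  have hlin : ∀ (l : ι → E) (q : E[X]), (fun i => C (l i)) ⬝ᵥ g = h * q →
      (fun i => C (l i)) ⬝ᵥ r = 0 ∧ (fun i => C (l i)) ⬝ᵥ s = q := by
    intro l q hl
    rw [hgsr, dotProduct_add, dotProduct_smul, smul_eq_mul] at hl
    have h1 : (fun i => C (l i)) ⬝ᵥ r = 0 := by
      refine eq_zero_of_dvd_of_natDegree_lt (p := h)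
        ⟨q - (fun i => C (l i)) ⬝ᵥ s, by linear_combination hl⟩ ?_
      refine lt_of_le_of_lt (natDegree_sum_le_of_forall_le (n := h.natDegree - 1) _ _ fun i _ => ?_)
        (by omega)
      refine (natDegree_C_mul_le _ _).trans ?_
      have := hrdeg i
      omega
    rw [h1, add_zero] at hl
    exact ⟨h1, mul_left_cancel₀ hh hl⟩
  set B := A.map (C : E →+* E[X]) with hB
  by_cases hr0 : r = 0
  · rw [hr0, add_zero] at hgsr
    refine ⟨s, ?_, fun l q hl => (hlin l q hl).2⟩
    rw [hgsr, quadEval_smul] at hg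
    refine mul_left_cancel₀ (mul_ne_zero hh hh) ?_
    rw [hg]; ring
  have hQr : quadEval B r ≠ 0 := fun h0 => hr0 (eq_zero_of_quadEval_map_C_eq_zero hA r h0)
  -- the new denominator
  set h' := p * h - h * quadEval B s - polarEval B s r with hh'
  have hQr' : quadEval B r = h * h' := by
    have h1 := hg
    rw [hgsr, quadEval_add, quadEval_smul, polarEval_smul_left] at h1
    rw [hh']
    linear_combination h1
  have hh'0 : h' ≠ 0 := by
    rintro h0
    rw [h0, mul_zero] at hQr'
    exact hQr hQr'
  have hdeg : h'.natDegree < h.natDegree := by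
    have h1 : (quadEval B r).natDegree ≤ (h.natDegree - 1) + (h.natDegree - 1) :=
      natDegree_quadEval_le A fun i => by have := hrdeg i; omega
    rw [hQr', natDegree_mul hh hh'0] at h1
    omega
  obtain ⟨g', hg', hl'⟩ := ih _ hdeg h' hh'0 (h' • s + (quadEval B s - p) • r) (by
    rw [quadEval_add, quadEval_smul, quadEval_smul, polarEval_smul_left, polarEval_smul_right, hQr',
      hh']
    ring) rfl
  refine ⟨g', hg', fun l q hl => hl' l q ?_⟩
  obtain ⟨h1, h2⟩ := hlin l q hl
  rw [dotProduct_add, dotProduct_smul, dotProduct_smul, h1, h2, smul_zero, add_zero, smul_eq_mul]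

end

end

/-! ### Generic representation and dimension -/

section

open Polynomial


section

variable {E ι κ : Type*} [Field E] [Fintype ι] [Fintype κ]

/-- The vector `X v + w` with polynomial entries. -/
noncomputable def linearVec (v w : ι → E) : ι → E[X] := (X : E[X]) • (C ∘ v) + C ∘ w

theorem quadEval_linearVec (A : Matrix ι ι E) (v w : ι → E) :
    quadEval (A.map C) (linearVec v w) =
      X * X * C (quadEval A v) + X * C (polarEval A v w) + C (quadEval A w) := by
  rw [linearVec, quadEval_add, quadEval_smul, polarEval_smul_left, quadEval_map, quadEval_map,
    polarEval_map]
  ring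

theorem polarEval_linearVec (A : Matrix ι ι E) (v w z : ι → E) :
    polarEval (A.map C) (linearVec v w) (C ∘ z) =
      X * C (polarEval A v z) + C (polarEval A w z) := by
  rw [linearVec, polarEval_add_left, polarEval_smul_left, polarEval_map, polarEval_map]

theorem linear_coeffs_eq {a b a' b' : E} (h : X * C a + C b = X * C a' + C b') :
    a = a' ∧ b = b' := by
  refine ⟨?_, ?_⟩
  · simpa using congrArg (fun p => coeff p 1) h
  · simpa using congrArg (fun p => coeff p 0) h

theorem quadratic_coeffs_eq {a b c a' b' c' : E}
    (h : X * X * C a + X * C b + C c = X * X * C a' + X * C b' + C c') :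
    a = a' ∧ b = b' ∧ c = c' := by
  have h0 : c = c' := by simpa using congrArg (fun p => coeff p 0) h
  subst h0
  have h1 : X * (X * C a + C b) = X * (X * C a' + C b') := by linear_combination h
  obtain ⟨h2, h3⟩ := linear_coeffs_eq (mul_left_cancel₀ X_ne_zero h1)
  exact ⟨h2, h3, rfl⟩

theorem polarEval_map_C_eq_dotProduct (A : Matrix ι ι E) (g : ι → E[X]) (z : ι → E) :
    polarEval (A.map C) g (C ∘ z) = (fun i => C ((A + A.transpose).mulVec z i)) ⬝ᵥ g := by
  rw [polarEval_eq_dotProduct, dotProduct_comm]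
  congr 1
  ext1 i
  have h : A.map C + (A.map C).transpose = (A + A.transpose).map (C : E →+* E[X]) := by
    ext1 i j; simp
  rw [h]
  exact (RingHom.map_mulVec C _ z i).symm

/-- If over `E(X)` the anisotropic form `A` has a vector with the value of `P` at `X e + x`, then a
vector with this value can be found that is linear in `X`, so that `A` represents over `E` the
restriction of `P` to the span of `e` and `x`. The products with finitely many fixed vectors are
preserved. -/
theorem exists_linear_representation {A : Matrix ι ι E} (hA : ∀ x, quadEval A x = 0 → x = 0)
    (P : Matrix κ κ E) {σ : Type*} (z : σ → ι → E) (d : σ → κ → E) (e x : κ → E)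
    (y : ι → FractionRing E[X])
    (hy : quadEval ((A.map C).map (algebraMap E[X] (FractionRing E[X]))) y =
      algebraMap E[X] (FractionRing E[X]) (quadEval (P.map C) (linearVec e x)))
    (hyz : ∀ i, polarEval ((A.map C).map (algebraMap E[X] (FractionRing E[X]))) y
      (algebraMap E[X] (FractionRing E[X]) ∘ C ∘ z i) =
      algebraMap E[X] (FractionRing E[X]) (polarEval (P.map C) (linearVec e x) (C ∘ d i))) :
    ∃ v w : ι → E, quadEval A v = quadEval P e ∧ polarEval A v w = polarEval P e x ∧
      quadEval A w = quadEval P x ∧ ∀ i, polarEval A v (z i) = polarEval P e (d i) ∧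
        polarEval A w (z i) = polarEval P x (d i) := by
  set a := algebraMap E[X] (FractionRing E[X])
  have ha : Function.Injective a := IsFractionRing.injective E[X] (FractionRing E[X])
  obtain ⟨⟨h, hh⟩, hb⟩ := IsLocalization.exist_integer_multiples_of_finite
    (nonZeroDivisors E[X]) y
  have hh0 : h ≠ 0 := nonZeroDivisors.ne_zero hh
  choose g hg using hb
  have hgy : a ∘ g = a h • y := by
    ext1 i
    refine (hg i).trans ?_
    exact Algebra.smul_def h (y i)
  obtain ⟨g', h1, h2⟩ := exists_polynomial_quadEval_eq hA (quadEval (P.map C) (linearVec e x)) h hh0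
    g (by
      apply ha
      rw [← quadEval_map, hgy, quadEval_smul, hy, map_mul, map_mul]
      ring)
  have h3 : ∀ i, polarEval (A.map C) g' (C ∘ z i) =
      polarEval (P.map C) (linearVec e x) (C ∘ d i) := by
    intro i
    rw [polarEval_map_C_eq_dotProduct]
    refine h2 _ _ ?_
    rw [← polarEval_map_C_eq_dotProduct]
    apply ha
    rw [← polarEval_map, hgy, polarEval_smul_left, hyz, map_mul]
  have hdeg : ∀ i, (g' i).natDegree ≤ 1 := by
    refine natDegree_le_of_natDegree_quadEval_le hA ?_
    rw [h1]
    refine natDegree_quadEval_le P fun i => ?_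
    change (X * C (e i) + C (x i)).natDegree ≤ 1
    rw [mul_comm]
    exact natDegree_linear_le
  have hg' : g' = linearVec (fun i => (g' i).coeff 1) (fun i => (g' i).coeff 0) := by
    ext1 i
    change g' i = X * C ((g' i).coeff 1) + C ((g' i).coeff 0)
    rw [mul_comm]
    exact eq_X_add_C_of_natDegree_le_one (hdeg i)
  rw [hg', quadEval_linearVec, quadEval_linearVec] at h1
  obtain ⟨e1, e2, e3⟩ := quadratic_coeffs_eq h1
  refine ⟨_, _, e1, e2, e3, fun i => linear_coeffs_eq ?_⟩
  rw [← polarEval_linearVec, ← polarEval_linearVec, ← hg', h3]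

theorem anisotropic_fractionRing {A : Matrix ι ι E} (hA : ∀ x, quadEval A x = 0 → x = 0)
    (y : ι → FractionRing E[X])
    (hy : quadEval ((A.map C).map (algebraMap E[X] (FractionRing E[X]))) y = 0) : y = 0 := by
  set a := algebraMap E[X] (FractionRing E[X])
  have ha : Function.Injective a := IsFractionRing.injective E[X] (FractionRing E[X])
  obtain ⟨⟨h, hh⟩, hb⟩ := IsLocalization.exist_integer_multiples_of_finite
    (nonZeroDivisors E[X]) y
  have hh0 : a h ≠ 0 := (map_ne_zero_iff a ha).mpr (nonZeroDivisors.ne_zero hh)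
  choose g hg using hb
  have hgy : a ∘ g = a h • y := by
    ext1 i
    refine (hg i).trans ?_
    exact Algebra.smul_def h (y i)
  have h1 : g = 0 := by
    refine eq_zero_of_quadEval_map_C_eq_zero hA g (ha ?_)
    rw [← quadEval_map, hgy, quadEval_smul, hy, mul_zero, map_zero]
  rw [h1] at hgy
  have h2 : a h • y = 0 := by
    rw [← hgy]; ext1 i; simp
  exact (smul_eq_zero.mp h2).resolve_left hh0

/-- Vectors `v` and `v'` with the same value are exchanged by the reflection in `v - v'`, which
preserves products with the vectors orthogonal to `v - v'`; here `y'` is the image of `y`. -/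
theorem exists_reflection {A : Matrix ι ι E} (hA : ∀ x, quadEval A x = 0 → x = 0) {v v' : ι → E}
    (hv : quadEval A v = quadEval A v') (y : ι → E) :
    ∃ y', quadEval A y' = quadEval A y ∧ polarEval A y' v' = polarEval A y v ∧
      ∀ z, polarEval A v z = polarEval A v' z → polarEval A y' z = polarEval A y z := by
  by_cases hw : v - v' = 0
  · rw [sub_eq_zero] at hw
    subst hw
    exact ⟨y, rfl, rfl, fun _ _ => rfl⟩
  have hq : quadEval A (v - v') ≠ 0 := fun h => hw (hA _ h)
  have hqe := quadEval_sub A v v'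
  set q := quadEval A (v - v') with hqd
  have hqi : q * q⁻¹ = 1 := mul_inv_cancel₀ hq
  have hbv : polarEval A (v - v') v' = - q := by
    rw [polarEval_sub_left, polarEval_self]
    linear_combination hqe + hv
  have hbv' : polarEval A y v' = polarEval A y v - polarEval A y (v - v') := by
    rw [polarEval_comm A y (v - v'), polarEval_sub_left, polarEval_comm A v, polarEval_comm A v']
    ring
  refine ⟨y - (polarEval A y (v - v') * q⁻¹) • (v - v'), ?_, ?_, fun z hz => ?_⟩
  · rw [quadEval_sub, quadEval_smul, polarEval_smul_right, ← hqd]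
    linear_combination (polarEval A y (v - v')) ^ 2 * q⁻¹ * hqi
  · rw [polarEval_sub_left, polarEval_smul_left, hbv, hbv']
    linear_combination (polarEval A y (v - v')) * hqi
  · rw [polarEval_sub_left, polarEval_smul_left, polarEval_sub_left A v, hz]
    ring

end

/-- If the anisotropic form `A` represents all values of the nonsingular form `P` over all extension
fields over which `A` stays anisotropic, then the dimension of `A` is at least that of `P`. In fact
`P` is a subform of `A`: images `zᵢ` of the basis vectors `eᵢ` are chosen one at a time, and it is
kept as an induction hypothesis that over every extension the values at the vectors supported on the
remaining coordinates are still represented, compatibly with the `zᵢ` already found. The next vector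
comes from adjoining a variable to the field, and reflections make it independent of the
extension. -/
theorem card_le_card_of_represents {F : Type u} [Field F] {ι κ : Type} [Fintype ι] [Fintype κ]
    {A : Matrix ι ι F} {P : Matrix κ κ F}
    (hA : ∀ x, quadEval A x = 0 → x = 0) (hP : ∀ x, (∀ y, polarEval P x y = 0) → x = 0)
    (H : ∀ (E : Type u) [Field E] (f : F →+* E), (∀ x, quadEval (A.map f) x = 0 → x = 0) →
      ∀ x : κ → E, ∃ y, quadEval (A.map f) y = quadEval (P.map f) x) :
    Fintype.card κ ≤ Fintype.card ι := by
  classical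
  have main : ∀ s : Finset κ, ∃ z : κ → ι → F,
      (∀ i ∈ s, ∀ k ∈ s, polarEval A (z i) (z k) =
        polarEval P (Pi.single i 1) (Pi.single k 1)) ∧
      ∀ (E : Type u) [Field E] (f : F →+* E), (∀ x, quadEval (A.map f) x = 0 → x = 0) →
        ∀ x : κ → E, (∀ i ∈ s, x i = 0) →
          ∃ y, quadEval (A.map f) y = quadEval (P.map f) x ∧
            ∀ i ∈ s, polarEval (A.map f) y (f ∘ z i) =
              polarEval (P.map f) x (f ∘ Pi.single i 1) := by
    intro s
    induction s using Finset.induction_on with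
    | empty =>
      refine ⟨0, by simp, fun E _ f hE x _ => ?_⟩
      obtain ⟨y, hy⟩ := H E f hE x
      exact ⟨y, hy, by simp⟩
    | insert j s hj ih =>
      obtain ⟨z, hz, hrep⟩ := ih
      -- adjoining a variable and descending to vectors linear in it
      have step : ∀ (E : Type u) [Field E] (f : F →+* E),
          (∀ x, quadEval (A.map f) x = 0 → x = 0) →
          ∀ x : κ → E, (∀ i ∈ insert j s, x i = 0) → ∃ v w : ι → E,
            quadEval (A.map f) v = quadEval (P.map f) (f ∘ Pi.single j 1) ∧
            polarEval (A.map f) v w = polarEval (P.map f) (f ∘ Pi.single j 1) x ∧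
            quadEval (A.map f) w = quadEval (P.map f) x ∧
            ∀ i : s, polarEval (A.map f) v (f ∘ z i) =
                polarEval (P.map f) (f ∘ Pi.single j 1) (f ∘ Pi.single i.1 1) ∧
              polarEval (A.map f) w (f ∘ z i) = polarEval (P.map f) x (f ∘ Pi.single i.1 1) := by
        intro E _ f hE x hx
        let a := algebraMap E[X] (FractionRing E[X])
        have hmap : ∀ {μ : Type} (B : Matrix μ μ F),
            B.map (a.comp (C.comp f)) = ((B.map f).map C).map a := by
          intro μ B
          ext i k
          rfl
        obtain ⟨y, hy, hyz⟩ := hrep (FractionRing E[X]) (a.comp (C.comp f))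
          (by rw [hmap]; exact anisotropic_fractionRing hE)
          (a ∘ linearVec (f ∘ Pi.single j 1) x) (fun i hi => by
            have hij : i ≠ j := by rintro rfl; exact hj hi
            have h1 : x i = 0 := hx i (Finset.mem_insert_of_mem hi)
            simp [linearVec, h1, hij])
        rw [hmap, hmap, quadEval_map] at hy
        refine exists_linear_representation hE (P.map f) (fun i : s => f ∘ z i)
          (fun i : s => f ∘ Pi.single i.1 1) _ x y hy fun i => ?_
        have h2 := hyz i i.2
        rw [hmap, hmap] at h2
        refine h2.trans ?_
        rw [← polarEval_map]
        rfl
      obtain ⟨v₀, w₀, hv1, -, -, hv2⟩ := step F (RingHom.id F) (by simpa using hA) 0 (by simp)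
      simp only [Matrix.map_id, RingHom.coe_id, Function.id_comp] at hv1 hv2
      have hself : polarEval A v₀ v₀ = polarEval P (Pi.single j 1) (Pi.single j 1) := by
        rw [polarEval_self, polarEval_self, hv1]
      have hne : ∀ i ∈ s, i ≠ j := by
        rintro i hi rfl
        exact hj hi
      have hup : ∀ i ∈ s, Function.update z j v₀ i = z i := fun i hi =>
        Function.update_of_ne (hne i hi) _ _
      refine ⟨Function.update z j v₀, ?_, ?_⟩
      · intro i hi k hk
        rcases Finset.mem_insert.mp hi with hij | his <;>
          rcases Finset.mem_insert.mp hk with hkj | hks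
        · rw [hij, hkj, Function.update_self, hself]
        · rw [hij, Function.update_self, hup k hks]
          exact (hv2 ⟨k, hks⟩).1
        · rw [hkj, Function.update_self, hup i his, polarEval_comm, polarEval_comm P]
          exact (hv2 ⟨i, his⟩).1
        · rw [hup i his, hup k hks]
          exact hz i his k hks
      · intro E _ f hE x hx
        obtain ⟨v, w, e1, e2, e3, e4⟩ := step E f hE x hx
        have hv : quadEval (A.map f) v = quadEval (A.map f) (f ∘ v₀) := by
          rw [e1, quadEval_map, quadEval_map, hv1]
        obtain ⟨y, h1, h2, h3⟩ := exists_reflection hE hv w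
        refine ⟨y, h1.trans e3, fun i hi => ?_⟩
        rcases Finset.mem_insert.mp hi with hij | his
        · rw [hij, Function.update_self, h2, polarEval_comm, e2, polarEval_comm]
        · rw [hup i his, h3, (e4 ⟨i, his⟩).2]
          rw [(e4 ⟨i, his⟩).1, polarEval_map, polarEval_map, (hv2 ⟨i, his⟩).1]
  obtain ⟨z, hz, -⟩ := main Finset.univ
  have hli : LinearIndependent F z := by
    rw [Fintype.linearIndependent_iff]
    intro c hc
    have hpol : ∀ k, polarEval P c (Pi.single k 1) = 0 := by
      intro k
      have hsumA : ∀ t : Finset κ, polarEval A (∑ i ∈ t, c i • z i) (z k) =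
          polarEval P (∑ i ∈ t, c i • Pi.single i 1) (Pi.single k 1) := by
        intro t
        induction t using Finset.induction_on with
        | empty => simp [polarEval]
        | insert i t hi ih =>
          rw [Finset.sum_insert hi, Finset.sum_insert hi, polarEval_add_left, polarEval_add_left,
            ih, polarEval_smul_left, polarEval_smul_left, hz i (Finset.mem_univ i) k
            (Finset.mem_univ k)]
      have h1 := hsumA Finset.univ
      rw [hc, ← pi_eq_sum_univ' c] at h1
      rw [← h1]
      simp [polarEval]
    have hc0 : c = 0 := by
      refine hP c fun y => ?_
      rw [polarEval_eq_dotProduct, Matrix.dotProduct_mulVec]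
      have h2 : Matrix.vecMul c (P + P.transpose) = 0 := by
        ext k
        have h3 := hpol k
        rw [polarEval_eq_dotProduct, Matrix.dotProduct_mulVec, dotProduct_single_one] at h3
        exact h3
      rw [h2, zero_dotProduct]
    intro i
    rw [hc0]; rfl
  have h := hli.fintype_card_le_finrank
  rwa [Module.finrank_pi] at h

end

/-! ### Dimensions of forms in the powers of the fundamental ideal -/

namespace EvenForm

open WittGroup Polynomial

variable {F : Type u} [Field F]

theorem scalarExt_form {E : Type u} [Field E] (f : F →+* E) (φ : EvenForm F)
    (x : Fin (Module.finrank F φ.carrier) → E) :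
    (scalarExt f φ).form x = quadEval (φ.gram.map f) x :=
  ofMatrix_form _ _ _ _

theorem finrank_scalarExt {E : Type u} [Field E] (f : F →+* E) (φ : EvenForm F) :
    Module.finrank E (scalarExt f φ).carrier = Module.finrank F φ.carrier :=
  (Module.finrank_fin_fun E : Module.finrank E (Fin _ → E) = _)

/-- An anisotropic form that is hyperbolic has dimension zero. -/
theorem finrank_eq_zero_of_anisotropic {φ : EvenForm F} (h : ∀ x, φ.form x = 0 → x = 0)
    (h0 : φ.wittClass = 0) : Module.finrank F φ.carrier = 0 := by
  obtain ⟨W, hW⟩ := wittClass_eq_zero_iff.mp h0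
  have h1 : W = ⊥ := by
    rw [Submodule.eq_bot_iff]
    exact fun x hx => h x (hW.1 x hx)
  have h2 := hW.2
  rw [h1, finrank_bot] at h2
  omega

/-- A nonzero anisotropic form that becomes hyperbolic over every extension over which the Pfister
form `π` does has at least the dimension of `π`. Let `a` be a value of the form and `π(v₀) = 1`.
Over the quadratic extension defined by `X² + b(v₀, x) X + π(x)` the form `π` is isotropic, so by
`exists_quadEval_eq_mul` the given form represents `a π(x)`, for all vectors `x` over all extensions
over which it stays anisotropic. -/
theorem finrank_le_of_forall_scalarExt {m : ℕ} {π q : EvenForm F} (hπ : IsPfister m π)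
    (hq : ∀ x, q.form x = 0 → x = 0) (hq0 : Module.finrank F q.carrier ≠ 0)
    (H : ∀ (L : Type u) [Field L] (f : F →+* L), (scalarExt f π).wittClass = 0 →
      (scalarExt f q).wittClass = 0) :
    Module.finrank F π.carrier ≤ Module.finrank F q.carrier := by
  obtain ⟨w, hw⟩ : ∃ w : Fin (Module.finrank F q.carrier) → F, w ≠ 0 := by
    have : Nonempty (Fin (Module.finrank F q.carrier)) := ⟨⟨0, Nat.pos_of_ne_zero hq0⟩⟩
    exact exists_ne 0
  have hA : ∀ x, quadEval q.gram x = 0 → x = 0 := by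
    intro x hx
    rw [← form_coord] at hx
    exact q.coord.map_eq_zero_iff.mp (hq _ hx)
  set a := quadEval q.gram w with ha
  have ha0 : a ≠ 0 := fun h => hw (hA w h)
  obtain ⟨v, hv⟩ := hπ.exists_eq_one
  obtain ⟨v, rfl⟩ := π.coord.surjective v
  rw [form_coord] at hv
  have key := card_le_card_of_represents (A := q.gram) (P := a • π.gram) hA ?_ ?_
  · simpa using key
  · intro x hx
    refine π.gram_nondegenerate x fun y => ?_
    have h1 := hx y
    rw [polarEval_smul_matrix] at h1
    exact (mul_eq_zero.mp h1).resolve_left ha0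
  intro E _ f hE x
  have hmap : (a • π.gram).map f = f a • π.gram.map f := by
    ext i j; simp
  rw [hmap, quadEval_smul_matrix]
  set B := π.gram.map f with hB
  set e := f ∘ v with he
  have he1 : quadEval B e = 1 := by rw [hB, he, quadEval_map, hv, map_one]
  have he0 : e ≠ 0 := by
    rintro h
    rw [h, quadEval_zero] at he1
    exact zero_ne_one he1
  have hwf : quadEval (q.gram.map f) (f ∘ w) = f a := quadEval_map _ f w
  set P : E[X] := X ^ 2 + C (polarEval B e x) * X + C (quadEval B x) with hP
  have hdeg : P.natDegree = 2 := by rw [hP]; compute_degree!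
  by_cases hirr : Irreducible P
  · have : Fact (Irreducible P) := ⟨hirr⟩
    let g := AdjoinRoot.of P
    let θ := AdjoinRoot.root P
    let y : Fin (Module.finrank F π.carrier) → AdjoinRoot P := θ • (g ∘ e) + g ∘ x
    have hy : quadEval (B.map g) y = 0 := by
      have h1 : P.eval₂ g θ = 0 := AdjoinRoot.eval₂_root P
      have h2 : P.eval₂ g θ = (X ^ 2 + C (polarEval B e x) * X + C (quadEval B x)).eval₂ g θ :=
        congrArg _ hP
      rw [h2] at h1
      simp only [eval₂_add, eval₂_mul, eval₂_pow, eval₂_X, eval₂_C] at h1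
      rw [quadEval_add, quadEval_smul, polarEval_smul_left, quadEval_map B g e,
        quadEval_map B g x, polarEval_map B g e x, he1, map_one]
      linear_combination h1
    have hy0 : y ≠ 0 := by
      intro h
      apply he0
      ext1 i
      have h1 : θ * g (e i) + g (x i) = 0 := congrFun h i
      have h2 : AdjoinRoot.mk P (C (e i) * X + C (x i)) = 0 := by
        rw [← h1]
        simp only [map_add, map_mul, AdjoinRoot.mk_C, AdjoinRoot.mk_X]
        ring
      rw [AdjoinRoot.mk_eq_zero] at h2
      have h3 := eq_zero_of_dvd_of_natDegree_lt h2
        (lt_of_le_of_lt natDegree_linear_le (by rw [hdeg]; norm_num))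
      simpa using congrArg (fun p => coeff p 1) h3
    have h1 : (scalarExt (g.comp f) π).wittClass = 0 :=
      (hπ.scalarExt (g.comp f)).isRound.1 y hy0 ((scalarExt_form _ _ _).trans hy)
    obtain ⟨M, hM1, hM2⟩ := wittClass_eq_zero_iff.mp (H _ _ h1)
    rw [finrank_scalarExt] at hM2
    obtain ⟨z, hz⟩ := exists_quadEval_eq_mul_of_adjoinRoot hP hE M
      (fun y hy => (scalarExt_form (g.comp f) q y).symm.trans (hM1 y hy)) hM2 (f ∘ w)
    exact ⟨z, by rw [hz, hwf, mul_comm]⟩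
  · have hmon : P.Monic := by rw [hP]; monicity!
    obtain ⟨r, hr⟩ : ∃ r, P.IsRoot r := by
      by_contra! h
      refine hirr ((hmon.irreducible_iff_roots_eq_zero_of_degree_le_three hdeg.ge
        (by rw [hdeg]; norm_num)).mpr ?_)
      rw [Multiset.eq_zero_iff_forall_notMem]
      exact fun r hr => h r (isRoot_of_mem_roots hr)
    have hr' : r * r + polarEval B e x * r + quadEval B x = 0 := by
      rw [← hr.eq_zero, hP]
      simp only [eval_add, eval_mul, eval_pow, eval_X, eval_C]
      ring
    have hu : quadEval B (r • e + x) = 0 := by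
      rw [quadEval_add, quadEval_smul, polarEval_smul_left, he1]
      linear_combination hr'
    by_cases hu0 : r • e + x = 0
    · have hx : x = (-r) • e := by
        rw [neg_smul]; exact eq_neg_of_add_eq_zero_right hu0
      refine ⟨r • (f ∘ w), ?_⟩
      rw [hx, quadEval_smul, quadEval_smul, he1, hwf]
      ring
    · exfalso
      have h1 : (scalarExt f π).wittClass = 0 :=
        (hπ.scalarExt f).isRound.1 (r • e + x) hu0 ((scalarExt_form _ _ _).trans hu)
      have h2 := finrank_eq_zero_of_anisotropic (φ := scalarExt f q)
        (fun y hy => hE y ((scalarExt_form f q y).symm.trans hy)) (H E f h1)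
      rw [finrank_scalarExt] at h2
      exact hq0 h2

/-- A sum of `r` scaled `m`-fold Pfister forms that is represented by a form of dimension less than
`2 ^ m` is zero, by induction on `r`: otherwise, by `finrank_le_of_forall_scalarExt`, some extension
makes one summand vanish but not the sum. -/
theorem wittClass_eq_zero_of_list (m : ℕ) : ∀ (r : ℕ) (F : Type u) [Field F]
    (l : List (WittGroup F)), l.length = r →
    (∀ w ∈ l, ∃ (a : Fˣ) (π : EvenForm F), IsPfister m π ∧ w = scaleHom a π.wittClass) →
    ∀ q : EvenForm F, q.wittClass = l.sum → Module.finrank F q.carrier < 2 ^ m →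
      q.wittClass = 0 := by
  intro r
  induction r with
  | zero =>
    intro F _ l hl _ q hq _
    rw [hq, List.length_eq_zero_iff.mp hl, List.sum_nil]
  | succ r ih =>
    intro F _ l hl hgen q hq hd
    obtain ⟨w, l, rfl⟩ := List.exists_cons_of_length_eq_add_one hl
    obtain ⟨a, π, hπ, rfl⟩ := hgen w List.mem_cons_self
    obtain ⟨q', hq', hd', han⟩ := exists_anisotropic q
    rw [← hq'] at hq ⊢
    by_contra hne
    have h0 : Module.finrank F q'.carrier ≠ 0 := by
      intro h0
      refine hne (wittClass_eq_zero_iff.mpr ⟨⊥, ?_, by omega⟩)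
      intro x hx
      rw [(Submodule.mem_bot F).mp hx, QuadraticMap.map_zero]
    have h1 := finrank_le_of_forall_scalarExt hπ han h0 fun L _ f hL => by
      refine ih L (l.map (scalarExtHom f)) (by simpa using hl) ?_ _ ?_
        (by rw [finrank_scalarExt]; omega)
      · intro w hw
        obtain ⟨w', hw', rfl⟩ := List.mem_map.mp hw
        obtain ⟨b, ρ, hρ, rfl⟩ := hgen w' (List.mem_cons_of_mem _ hw')
        exact ⟨_, _, hρ.scalarExt f, scalarExtHom_scaleHom f b _⟩
      · rw [← scalarExtHom_wittClass, hq, List.sum_cons, map_add, scalarExtHom_scaleHom,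
          scalarExtHom_wittClass, hL, map_zero, zero_add, map_list_sum]
    rw [hπ.finrank_eq] at h1
    omega

/-- The Arason–Pfister Hauptsatz. -/
theorem wittClass_eq_zero_of_mem_Iq {m : ℕ} {q : EvenForm F} (hq : q.wittClass ∈ Iq F m)
    (hd : Module.finrank F q.carrier < 2 ^ m) : q.wittClass = 0 := by
  rw [Iq, ← AddSubgroup.mem_toAddSubmonoid, AddSubgroup.closure_toAddSubmonoid] at hq
  obtain ⟨l, hl, hsum⟩ := AddSubmonoid.exists_list_of_mem_closure hq
  refine wittClass_eq_zero_of_list m _ F l rfl (fun w hw => ?_) q hsum.symm hd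
  rcases hl w hw with ⟨a, π, hπ, rfl⟩ | ⟨a, π, hπ, h⟩
  · exact ⟨a, π, hπ, rfl⟩
  · refine ⟨-1 * a, π, hπ, ?_⟩
    rw [← scaleHom_scaleHom, scaleHom_neg_one, scaleHom_wittClass, ← h, neg_neg]

/-- Pfister forms are determined by their class in `I_q^m / I_q^{m+1}`: the difference of two
`m`-fold Pfister forms is isotropic of dimension `2 ^ (m + 1)`. -/
theorem IsPfister.wittClass_eq_of_sub_mem {m : ℕ} {φ ψ : EvenForm F} (hφ : IsPfister m φ)
    (hψ : IsPfister m ψ) (h : φ.wittClass - ψ.wittClass ∈ Iq F (m + 1)) :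
    φ.wittClass = ψ.wittClass := by
  obtain ⟨x, hx⟩ := hφ.exists_eq_one
  obtain ⟨y, hy⟩ := hψ.exists_eq_one
  have hx0 : x ≠ 0 := by
    rintro rfl
    rw [QuadraticMap.map_zero] at hx
    exact zero_ne_one hx
  obtain ⟨q, hq, hd⟩ := exists_wittClass_eq_of_isotropic (φ := orthSum φ (scale (-1) ψ))
    (v := (x, y)) (fun h0 => hx0 (congrArg Prod.fst h0)) (by
      change φ.form x + ((-1 : Fˣ) : F) * ψ.form y = 0
      rw [hx, hy]; simp)
  rw [finrank_orthSum, finrank_scale, hφ.finrank_eq, hψ.finrank_eq, ← two_mul, ← pow_succ'] at hd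
  rw [wittClass_orthSum, wittClass_scale_neg_one, ← sub_eq_add_neg] at hq
  rw [← hq] at h
  have h0 := wittClass_eq_zero_of_mem_Iq h (by omega)
  rwa [hq, sub_eq_zero] at h0

end EvenForm

/-! ### Right multiples of a fixed Pfister form -/

namespace WittGroup

open EvenForm

variable {F : Type u} [Field F]

/-- If `-1` is a square or the characteristic is two, then the Witt group has exponent two. -/
theorem neg_eq_self (hF : ringChar F ≠ 2 → IsSquare (-1 : F)) (x : WittGroup F) : -x = x := by
  rw [← scaleHom_neg_one]
  by_cases h : ringChar F = 2
  · have h1 : (-1 : Fˣ) = 1 := by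
      have : CharP F 2 := ringChar.of_eq h
      ext
      rw [Units.val_neg, Units.val_one, CharTwo.neg_eq]
    rw [h1, scaleHom_one]
  · obtain ⟨i, hi⟩ := hF h
    have hi0 : i ≠ 0 := by
      rintro rfl
      simp at hi
    have h1 : (-1 : Fˣ) = Units.mk0 i hi0 * Units.mk0 i hi0 := by
      ext
      simpa using hi
    rw [h1, scaleHom_mul_self]

theorem add_self_eq_zero (hF : ringChar F ≠ 2 → IsSquare (-1 : F)) (x : WittGroup F) :
    x + x = 0 := by
  nth_rw 1 [← neg_eq_self hF x]
  exact neg_add_cancel x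

end WittGroup

namespace EvenForm

open WittGroup

variable {F : Type u} [Field F]

theorem pfisterMul_congr {φ ψ : EvenForm F} (h : Isometric φ ψ) (l : List Fˣ) :
    Isometric (pfisterMul l φ) (pfisterMul l ψ) := by
  induction l with
  | nil => exact h
  | cons β l ih => exact orthSum_congr ih (scale_congr β ih)

theorem pfisterMul_append (l l' : List Fˣ) (φ : EvenForm F) :
    pfisterMul (l ++ l') φ = pfisterMul l (pfisterMul l' φ) := by
  induction l with
  | nil => rfl
  | cons β l ih => rw [List.cons_append, pfisterMul, pfisterMul, ih]

theorem IsPfister.pfisterMul {n : ℕ} {φ : EvenForm F} (h : IsPfister n φ) (l : List Fˣ) :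
    IsPfister (l.length + n) (pfisterMul l φ) := by
  obtain ⟨l', α, hα, rfl, e⟩ := h
  refine ⟨l ++ l', α, hα, by rw [List.length_append, add_assoc], ?_⟩
  rw [pfisterMul_append]
  exact pfisterMul_congr e l

theorem IsPfister.wittClass_mem_Iq {n : ℕ} {φ : EvenForm F} (h : IsPfister n φ) :
    φ.wittClass ∈ Iq F n :=
  AddSubgroup.subset_closure ⟨1, φ, h, (scale_one φ).wittClass_eq.symm⟩

/-- There is a hyperbolic `n`-fold Pfister form for each `n ≥ 1`. -/
theorem exists_isPfister_wittClass_eq_zero {n : ℕ} (hn : 1 ≤ n) :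
    ∃ π : EvenForm F, IsPfister n π ∧ π.wittClass = 0 := by
  have h0 : IsPfister 1 (binary (0 : F) (by simp)) := ⟨[], 0, by simp, rfl, Isometric.refl _⟩
  have h1 : (binary (0 : F) (by simp)).wittClass = 0 :=
    h0.isRound.1 ((0, 1) : F × F) (fun h => one_ne_zero (congrArg Prod.snd h))
      (by rw [binary_form]; simp)
  refine ⟨EvenForm.pfisterMul (List.replicate (n - 1) 1) (binary 0 (by simp)), ?_, ?_⟩
  · have h2 := h0.pfisterMul (List.replicate (n - 1) 1)
    rwa [List.length_replicate, Nat.sub_add_cancel hn] at h2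
  · induction n - 1 with
    | zero => exact h1
    | succ k ih =>
      rw [List.replicate_succ, EvenForm.pfisterMul, wittClass_orthSum, ← scaleHom_wittClass, ih,
        map_zero, add_zero]

theorem wittClass_pfisterMul_singleton (β : Fˣ) (φ : EvenForm F) :
    (pfisterMul [β] φ).wittClass = φ.wittClass + scaleHom β φ.wittClass := rfl

theorem wittClass_pfisterMul_pair (β γ : Fˣ) (φ : EvenForm F) :
    (pfisterMul [β, γ] φ).wittClass = φ.wittClass + scaleHom γ φ.wittClass +
      (scaleHom β φ.wittClass + scaleHom (β * γ) φ.wittClass) := by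
  rw [← scaleHom_scaleHom, ← map_add]
  rfl

/-- Expansion of `⟨⟨β₁, …, βₛ⟩⟩ ⊗ φ = ∏ (1 + βᵢ) φ`. The computation takes place in the commutative
group ring of `Fˣ`, which acts on the Witt group. -/
theorem wittClass_pfisterMul_ofFn {s : ℕ} (β : Fin s → Fˣ) (φ : EvenForm F) :
    (pfisterMul (List.ofFn β) φ).wittClass =
      ∑ T : Finset (Fin s), scaleHom (∏ i ∈ T, β i) φ.wittClass := by
  let ρ : MonoidAlgebra ℤ Fˣ →ₐ[ℤ] AddMonoid.End (WittGroup F) :=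
    MonoidAlgebra.lift ℤ (AddMonoid.End (WittGroup F)) Fˣ scaleHom
  have hρ : ∀ a : Fˣ, ρ (MonoidAlgebra.of ℤ Fˣ a) = scaleHom a := fun a =>
    MonoidAlgebra.lift_of _ _
  have hlist : ∀ l : List Fˣ, (pfisterMul l φ).wittClass =
      ρ (l.map fun b => 1 + MonoidAlgebra.of ℤ Fˣ b).prod φ.wittClass := by
    intro l
    induction l with
    | nil => rw [List.map_nil, List.prod_nil, map_one]; rfl
    | cons b l ih =>
      rw [List.map_cons, List.prod_cons, map_mul, map_add, map_one, hρ]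
      change _ = ρ _ φ.wittClass + scaleHom b (ρ _ φ.wittClass)
      rw [← ih]
      rfl
  rw [hlist, List.map_ofFn, List.prod_ofFn]
  simp only [Function.comp_apply]
  rw [Finset.prod_one_add, map_sum, Finset.powerset_univ]
  simp only [← map_prod, hρ]
  exact map_sum (AddMonoidHom.eval φ.wittClass) _ _

end EvenForm

/-- In a group of order `2 ^ s` and exponent two there are `s` elements whose subset sums are the
elements of the group, each occurring once. -/
theorem exists_bijective_subset_sums {G : Type*} [AddCommGroup G] (h2 : ∀ x : G, x + x = 0) {s : ℕ}
    (hcard : Nat.card G = 2 ^ s) :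
    ∃ g : Fin s → G, Function.Bijective fun T : Finset (Fin s) => ∑ i ∈ T, g i := by
  have : Finite G := Nat.finite_of_card_ne_zero (by rw [hcard]; positivity)
  let _ : Module (ZMod 2) G := AddCommGroup.zmodModule fun x => by rw [two_nsmul, h2]
  have hs : Module.finrank (ZMod 2) G = s := by
    have h := Module.natCard_eq_pow_finrank (K := ZMod 2) (V := G)
    rw [hcard, Nat.card_zmod] at h
    exact (Nat.pow_right_injective le_rfl h).symm
  let b := Module.finBasisOfFinrankEq (ZMod 2) G hs
  refine ⟨b, (Nat.bijective_iff_surjective_and_card _).mpr ⟨fun x => ?_, ?_⟩⟩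
  · refine ⟨Finset.univ.filter fun i => b.repr x i = 1, ?_⟩
    conv_rhs => rw [← b.sum_repr x]
    refine (Finset.sum_filter _ _).trans ?_
    refine Finset.sum_congr rfl fun i _ => ?_
    rcases (by decide : ∀ c : ZMod 2, c = 0 ∨ c = 1) (b.repr x i) with hc | hc
    · rw [hc, if_neg zero_ne_one, zero_smul]
    · rw [hc, if_pos rfl, one_smul]
  · rw [hcard, Nat.card_eq_fintype_card, Fintype.card_finset, Fintype.card_fin]

section

open EvenForm WittGroup

variable {F : Type u} [Field F]

/-- Pfister representatives are unique. -/
theorem IsPfisterRep.unique {n : ℕ} {g : IqQuot F n} {x y : Iq F n} (hx : IsPfisterRep n g x)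
    (hy : IsPfisterRep n g y) : x = y := by
  obtain ⟨⟨φ, hφ, hφx⟩, hxg⟩ := hx
  obtain ⟨⟨ψ, hψ, hψy⟩, hyg⟩ := hy
  have h := QuotientAddGroup.eq.mp (hyg.trans hxg.symm)
  rw [AddSubgroup.mem_addSubgroupOf] at h
  refine Subtype.ext ?_
  rw [← hφx, ← hψy]
  refine hφ.wittClass_eq_of_sub_mem hψ ?_
  rw [hφx, hψy, sub_eq_neg_add]
  exact h

theorem IsPfisterRep.pfisterRep_eq {n : ℕ} {g : IqQuot F n} {x : Iq F n}
    (hx : IsPfisterRep n g x) : pfisterRep n g = x := by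
  have h : ∃ x, IsPfisterRep n g x := ⟨x, hx⟩
  rw [pfisterRep, dif_pos h]
  exact h.choose_spec.unique hx

variable {n : ℕ} {φ : EvenForm F}

theorem isPfister_pfisterMul_singleton (hn : 2 ≤ n) (hφ : IsPfister (n - 1) φ) (β : Fˣ) :
    IsPfister n (pfisterMul [β] φ) := by
  have h := hφ.pfisterMul [β]
  rwa [List.length_singleton, Nat.add_sub_cancel' (by omega)] at h

/-- The class of `⟨⟨β⟩⟩ ⊗ φ` in `I_q^n`, for an `(n - 1)`-fold Pfister form `φ`. -/
noncomputable def pfisterMulIq (hn : 2 ≤ n) (hφ : IsPfister (n - 1) φ) (β : Fˣ) : Iq F n :=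
  ⟨(pfisterMul [β] φ).wittClass, (isPfister_pfisterMul_singleton hn hφ β).wittClass_mem_Iq⟩

theorem isPfisterRep_pfisterMulIq (hn : 2 ≤ n) (hφ : IsPfister (n - 1) φ) (β : Fˣ) :
    IsPfisterRep n (QuotientAddGroup.mk (pfisterMulIq hn hφ β) : IqQuot F n)
      (pfisterMulIq hn hφ β) :=
  ⟨⟨_, isPfister_pfisterMul_singleton hn hφ β, rfl⟩, rfl⟩

/-- Modulo `I_q^{n+1}`, the class of `⟨⟨β⟩⟩ ⊗ φ` is additive in `β`, because
`⟨⟨β⟩⟩ ⊗ φ + ⟨⟨γ⟩⟩ ⊗ φ + ⟨⟨βγ⟩⟩ ⊗ φ = ⟨⟨β, γ⟩⟩ ⊗ φ` in a Witt group of exponent two. -/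
noncomputable def pfisterMulHom (hF : ringChar F ≠ 2 → IsSquare (-1 : F)) (hn : 2 ≤ n)
    (hφ : IsPfister (n - 1) φ) : Additive Fˣ →+ IqQuot F n :=
  AddMonoidHom.mk' (fun β => (QuotientAddGroup.mk (pfisterMulIq hn hφ β.toMul) : IqQuot F n)) <| by
    intro β γ
    rw [← QuotientAddGroup.mk_add, QuotientAddGroup.eq, AddSubgroup.mem_addSubgroupOf]
    have h := (hφ.pfisterMul [β.toMul, γ.toMul]).wittClass_mem_Iq
    have h1 : [β.toMul, γ.toMul].length + (n - 1) = n + 1 := by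
      change 2 + (n - 1) = n + 1
      omega
    rw [h1] at h
    convert! h using 1
    rw [AddSubgroup.coe_add, AddSubgroup.coe_neg, neg_eq_self hF, AddSubgroup.coe_add]
    simp only [pfisterMulIq, wittClass_pfisterMul_pair, wittClass_pfisterMul_singleton, toMul_add]
    have h2 := add_self_eq_zero hF φ.wittClass
    generalize scaleHom (β.toMul * γ.toMul) φ.wittClass = x
    generalize scaleHom β.toMul φ.wittClass = y
    generalize scaleHom γ.toMul φ.wittClass = z
    generalize φ.wittClass = w at h2
    calc w + x + (w + y + (w + z)) = (w + w) + (w + z + (y + x)) := by abel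
      _ = w + z + (y + x) := by rw [h2, zero_add]

theorem generatedGroup_le_range (hF : ringChar F ≠ 2 → IsSquare (-1 : F)) (hn : 2 ≤ n)
    (hφ : IsPfister (n - 1) φ) {S : Set (EvenForm F)} (hS : ∀ ψ ∈ S, IsRightDivisor 1 φ ψ) :
    generatedGroup n S ≤ (pfisterMulHom hF hn hφ).range := by
  refine (AddSubgroup.closure_le _).mpr ?_
  rintro _ ⟨x, ⟨ψ, hψ, hx⟩, rfl⟩
  obtain ⟨l, hl, e⟩ := hS ψ hψ
  obtain ⟨β, rfl⟩ := List.length_eq_one_iff.mp hl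
  refine ⟨Additive.ofMul β, congrArg QuotientAddGroup.mk (Subtype.ext ?_)⟩
  rw [← hx, e.wittClass_eq]
  rfl

theorem existsUnique_isPfisterRep (hF : ringChar F ≠ 2 → IsSquare (-1 : F)) (hn : 2 ≤ n)
    (hφ : IsPfister (n - 1) φ) {S : Set (EvenForm F)} (hS : ∀ ψ ∈ S, IsRightDivisor 1 φ ψ)
    {g : IqQuot F n} (hg : g ∈ generatedGroup n S) : ∃! x : Iq F n, IsPfisterRep n g x := by
  obtain ⟨β, rfl⟩ := generatedGroup_le_range hF hn hφ hS hg
  exact ⟨_, isPfisterRep_pfisterMulIq hn hφ β.toMul,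
    fun y hy => hy.unique (isPfisterRep_pfisterMulIq hn hφ β.toMul)⟩

/-- The `βᵢ` map to a basis of the generated group over `𝔽₂`. Each representative
`⟨⟨∏_{i ∈ T} βᵢ⟩⟩ ⊗ φ` contributes one copy of `φ` to the sum, so that `2 ^ s` copies appear. -/
theorem exists_generators (hF : ringChar F ≠ 2 → IsSquare (-1 : F)) (hn : 2 ≤ n)
    (hφ : IsPfister (n - 1) φ) {S : Set (EvenForm F)} (hS : ∀ ψ ∈ S, IsRightDivisor 1 φ ψ)
    {s : ℕ} (hcard : Nat.card (generatedGroup n S) = 2 ^ s) :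
    ∃ β : Fin s → Fˣ,
      (∀ g : IqQuot F n, g ∈ generatedGroup n S ↔
        ∃ (T : Finset (Fin s)) (x : Iq F n), (pfisterMul [∏ i ∈ T, β i] φ).wittClass = x ∧
          (QuotientAddGroup.mk x : IqQuot F n) = g) ∧
      (sigmaInvariant n S : WittGroup F) =
        2 ^ s • φ.wittClass + (pfisterMul (List.ofFn β) φ).wittClass := by
  have h2 : ∀ x : generatedGroup n S, x + x = 0 := by
    rintro ⟨x, hx⟩
    refine Subtype.ext ?_
    obtain ⟨y, rfl⟩ := QuotientAddGroup.mk_surjective x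
    change (QuotientAddGroup.mk y + QuotientAddGroup.mk y : IqQuot F n) = 0
    rw [← QuotientAddGroup.mk_add, show y + y = 0 from Subtype.ext (add_self_eq_zero hF y.1)]
    rfl
  obtain ⟨g, hg⟩ := exists_bijective_subset_sums h2 hcard
  choose β hβ using fun i => generatedGroup_le_range hF hn hφ hS (g i).2
  have hsum : ∀ T : Finset (Fin s), ((∑ i ∈ T, g i : generatedGroup n S) : IqQuot F n) =
      QuotientAddGroup.mk (pfisterMulIq hn hφ (∏ i ∈ T, (β i).toMul)) := by
    intro T
    rw [AddSubgroup.val_finsetSum, ← Finset.sum_congr rfl fun i _ => hβ i, ← map_sum]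
    change QuotientAddGroup.mk (pfisterMulIq hn hφ (∑ i ∈ T, β i).toMul) = _
    rw [toMul_sum]
  refine ⟨fun i => (β i).toMul, fun x => ⟨fun hx => ?_, ?_⟩, ?_⟩
  · obtain ⟨T, hT⟩ := hg.2 ⟨x, hx⟩
    refine ⟨T, pfisterMulIq hn hφ (∏ i ∈ T, (β i).toMul), rfl, ?_⟩
    rw [← hsum]
    exact congrArg Subtype.val hT
  · rintro ⟨T, y, hy, rfl⟩
    have h3 : y = pfisterMulIq hn hφ (∏ i ∈ T, (β i).toMul) := Subtype.ext hy.symm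
    rw [h3, ← hsum]
    exact SetLike.coe_mem _
  · have h3 : sigmaInvariant n S =
        ∑ T : Finset (Fin s), pfisterMulIq hn hφ (∏ i ∈ T, (β i).toMul) := by
      rw [sigmaInvariant, ← finsum_comp_equiv (Equiv.ofBijective _ hg),
        finsum_eq_sum_of_fintype]
      refine Finset.sum_congr rfl fun T _ => ?_
      rw [Equiv.ofBijective_apply, hsum]
      exact (isPfisterRep_pfisterMulIq hn hφ _).pfisterRep_eq
    rw [h3, AddSubgroup.val_finsetSum, wittClass_pfisterMul_ofFn]
    have h4 : ∀ T : Finset (Fin s), (pfisterMulIq hn hφ (∏ i ∈ T, (β i).toMul) : WittGroup F) =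
        φ.wittClass + scaleHom (∏ i ∈ T, (β i).toMul) φ.wittClass := fun T => rfl
    simp only [h4]
    rw [Finset.sum_add_distrib, Finset.sum_const, Finset.card_univ, Fintype.card_finset,
      Fintype.card_fin]

end

theorem mainTheorem5 {F : Type u} [Field F] (hF : ringChar F ≠ 2 → IsSquare (-1 : F))
    (n s : ℕ) (hn : 2 ≤ n) (S : Set (EvenForm F)) (hS : ∀ ψ ∈ S, ψ.IsPfister n)
    (hlinked : EvenForm.RightLinked n S) (hcard : Nat.card (generatedGroup n S) = 2 ^ s) :
    (∀ g ∈ generatedGroup n S, ∃! x : Iq F n, IsPfisterRep n g x) ∧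
    (∃ π : EvenForm F, π.IsPfister (n + s - 1) ∧
      (sigmaInvariant n S : WittGroup F) = π.wittClass) ∧
    (1 ≤ s → ∀ φ : EvenForm F, φ.IsPfister (n - 1) →
      (∀ ψ ∈ S, EvenForm.IsRightDivisor 1 φ ψ) →
      ∃ β : Fin s → Fˣ,
        (∀ g : IqQuot F n, g ∈ generatedGroup n S ↔
          ∃ (T : Finset (Fin s)) (x : Iq F n),
            (EvenForm.pfisterMul [∏ i ∈ T, β i] φ).wittClass = x ∧
            (QuotientAddGroup.mk x : IqQuot F n) = g) ∧
        (sigmaInvariant n S : WittGroup F) = (EvenForm.pfisterMul (List.ofFn β) φ).wittClass) := by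
  have hcancel : 1 ≤ s → ∀ x : WittGroup F, 2 ^ s • x = 0 := by
    intro hs x
    obtain ⟨k, rfl⟩ := Nat.exists_eq_add_of_le' hs
    rw [pow_succ, mul_nsmul, two_nsmul, WittGroup.add_self_eq_zero hF]
  obtain ⟨φ, hφ, hdiv⟩ := hlinked
  refine ⟨fun g hg => existsUnique_isPfisterRep hF hn hφ hdiv hg, ?_, fun hs φ' hφ' hdiv' => ?_⟩
  · obtain ⟨β, -, hsum⟩ := exists_generators hF hn hφ hdiv hcard
    rcases Nat.eq_zero_or_pos s with rfl | hs
    · -- the only representative is zero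
      obtain ⟨π, hπ, hπ0⟩ := EvenForm.exists_isPfister_wittClass_eq_zero (F := F) (n := n + 0 - 1)
        (by omega)
      refine ⟨π, hπ, ?_⟩
      rw [hsum, hπ0, pow_zero, one_nsmul]
      exact WittGroup.add_self_eq_zero hF φ.wittClass
    · refine ⟨_, ?_, by rw [hsum, hcancel hs, zero_add]⟩
      have h := hφ.pfisterMul (List.ofFn β)
      rwa [List.length_ofFn, show s + (n - 1) = n + s - 1 by omega] at h
  · obtain ⟨β, hβ, hsum⟩ := exists_generators hF hn hφ' hdiv' hcard
    exact ⟨β, hβ, by rw [hsum, hcancel hs, zero_add]⟩
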